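/- Let $\omega(p)=|p|$ on $\mathbb R^3$, let $\mathcal H=L^2(\mathbb R^3,(2\omega)^{-1}dp;\mathbb C^3)$ with scalar product $(\cdot,\cdot)$ antilinear in the first argument, and let $\mathcal H_T=\{h\in\mathcal H:\ p\cdot h(p)=0 \text{ for a.e. } p\}$ be the one-photon space. It is the range of the orthogonal projection $(Ph)_j(p)=\sum_k(\delta_{jk}-p_jp_k/|p|^2)h_k(p)$. Let $\mathcal F=\bigoplus_{n\ge 0}\mathcal H_T^{\,n}$ be the symmetric Fock space over $\mathcal H_T$, with vacuum $\Omega_0$, creation and annihilation operators $a^*(h),a(h)$ normalized by $[a(h_1),a^*(h_2)]=(h_1,h_2)$, field operators $A_\circ(h)=\frac1{\sqrt2}(a^*(h)+a(h))$ and Weyl operators $W(h)=e^{iA_\circ(h)}$. Let $$\mathcal S=\{h\in\mathcal H_T:\ \text{for every } k\ge 0 \text{ there is } C \text{ with } |h(p)|\le C(1+|p|^2)^{-k}\ \text{a.e.}\},$$ let $\mathfrak A$ be the $C^*$-algebra of operators on $\mathcal F$ generated by $\{W(h):h\in\mathcal S\}$, and let $\omega_{in}(B)=(\Omega_0,B\Omega_0)$.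 A state on $\mathfrak A$ (a positive linear functional of norm one) is called a Fock state if it has the form $B\mapsto(\Psi,B\Psi)$ for a vector $\Psi\in\mathcal F$ with $\|\Psi\|=1$. Let $x:\mathbb R\to\mathbb R^3$ be a trajectory that is absolutely continuous on every bounded interval and whose velocity $x'$ has compact support. Set $$J(p)=-i(2\pi)^{-3/2}\int_{\mathbb R}x'(s)\,e^{i|p|s-ip\cdot x(s)}\,ds,\qquad J_T(p)=P(p)J(p),\qquad (J_T,h)=\int\overline{J_T(p)}\cdot h(p)\,\frac{dp}{2\omega}\quad(h\in\mathcal S).$$ Then there is exactly one state $\omega_{out}$ on $\mathfrak A$ with $$\omega_{out}(W(h))=\omega_{in}(W(h))\,e^{i\sqrt2\,\mathrm{Re}(J_T,h)}\qquad\text{for all } h\in\mathcal S,$$ and $\omega_{out}$ is a Fock state if and only if $J_T\in\mathcal H_T$. -/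

import Mathlib

noncomputable section

namespace PhotonField

open MeasureTheory
open scoped ComplexOrder ENNReal

section Exponential
variable {F : Type*} [NormedAddCommGroup F] [InnerProductSpace ℂ F]

/-- The `k`-th term `(i A)^k ψ / k!` of the exponential series of `i A` applied to a vector `ψ`, for an
operator `A` that maps the (dense) domain `D` to itself. -/
def expTerm {D : Submodule ℂ F} (A : D →ₗ[ℂ] D) (ψ : D) (k : ℕ) : F :=
  (Complex.I ^ k / (k.factorial : ℂ)) • (((A ^ k) ψ : D) : F)

theorem inner_pow_pow {D : Submodule ℂ F} {A : D →ₗ[ℂ] D}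
    (hA : ∀ ψ φ : D, inner ℂ ((A ψ : D) : F) (φ : F) = inner ℂ (ψ : F) ((A φ : D) : F))
    (ψ : D) (j k : ℕ) (φ : D) :
    inner ℂ (((A ^ j) ψ : D) : F) (((A ^ k) φ : D) : F)
      = inner ℂ (ψ : F) (((A ^ (j + k)) φ : D) : F) := by
  induction j generalizing k with
  | zero => simp
  | succ j ih =>
    rw [pow_succ', Module.End.mul_apply, hA, ← Module.End.mul_apply, ← pow_succ', ih]
    congr 4; ring_nf

theorem norm_tsum_expTerm [CompleteSpace F] {D : Submodule ℂ F} {A : D →ₗ[ℂ] D}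
    (hA : ∀ ψ φ : D, inner ℂ ((A ψ : D) : F) (φ : F) = inner ℂ (ψ : F) ((A φ : D) : F))
    (ψ : D) (hs : Summable fun k => ‖expTerm A ψ k‖) :
    ‖∑' k, expTerm A ψ k‖ = ‖(ψ : F)‖ := by
  set a := expTerm A ψ with ha
  have hsum : HasSum a (∑' k, a k) := hs.of_norm.hasSum
  have hprod : Summable fun x : ℕ × ℕ => inner ℂ (a x.1) (a x.2) := by
    refine Summable.of_norm_bounded
      (hs.mul_of_nonneg hs (fun _ => norm_nonneg _) (fun _ => norm_nonneg _)) fun x => ?_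
    exact norm_inner_le_norm _ _
  have h1 : inner ℂ (∑' k, a k) (∑' k, a k) = ∑' x : ℕ × ℕ, inner ℂ (a x.1) (a x.2) := by
    rw [hprod.tsum_prod]
    have e2 : ∀ j, ∑' k, inner ℂ (a j) (a k) = inner ℂ (a j) (∑' k, a k) := fun j =>
      ((innerSL ℂ (a j)).hasSum hsum).tsum_eq
    simp only [e2]
    have := (ContinuousLinearMap.hasSum (innerSL ℂ (∑' k, a k)) hsum).star
    simp only [innerSL_apply_apply] at this
    have h3 := this.tsum_eq
    simp only [← starRingEnd_apply, inner_conj_symm] at h3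
    exact h3.symm
  have h2 : ∀ n, ∑ x ∈ Finset.HasAntidiagonal.antidiagonal n, inner ℂ (a x.1) (a x.2)
      = if n = 0 then inner ℂ (ψ : F) (ψ : F) else 0 := by
    intro n
    have e : ∀ x ∈ Finset.HasAntidiagonal.antidiagonal n, inner ℂ (a x.1) (a x.2) =
        ((n.choose x.1 : ℂ) * ((-Complex.I) ^ x.1 * Complex.I ^ x.2)) *
          (inner ℂ (ψ : F) (((A ^ n) ψ : D) : F) / n.factorial) := by
      intro x hx
      have hx' : x.1 + x.2 = n := Finset.HasAntidiagonal.mem_antidiagonal.1 hx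
      subst hx'
      rw [ha, expTerm, expTerm, inner_smul_left, inner_smul_right, inner_pow_pow hA,
        Nat.cast_choose ℂ (Nat.le_add_right x.1 x.2), Nat.add_sub_cancel_left]
      have f1 : (x.1.factorial : ℂ) ≠ 0 := by exact_mod_cast Nat.factorial_ne_zero _
      have f2 : (x.2.factorial : ℂ) ≠ 0 := by exact_mod_cast Nat.factorial_ne_zero _
      have f3 : ((x.1 + x.2).factorial : ℂ) ≠ 0 := by exact_mod_cast Nat.factorial_ne_zero _
      simp only [map_div₀, map_pow, Complex.conj_I, map_natCast]
      field_simp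
    rw [Finset.sum_congr rfl e, ← Finset.sum_mul]
    have b := (Commute.all (-Complex.I) Complex.I).add_pow' n
    simp only [nsmul_eq_mul] at b
    rw [← b, neg_add_cancel]
    by_cases hn : n = 0
    · subst hn; simp
    · simp [hn]
  have h4 : ∑' x : ℕ × ℕ, inner ℂ (a x.1) (a x.2) = inner ℂ (ψ : F) (ψ : F) := by
    rw [← Finset.HasAntidiagonal.sigmaAntidiagonalEquivProd.tsum_eq]
    have hs' := (Finset.HasAntidiagonal.sigmaAntidiagonalEquivProd.summable_iff
      (f := fun x : ℕ × ℕ => inner ℂ (a x.1) (a x.2))).2 hprod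
    refine (Summable.tsum_sigma' (fun n => (hasSum_fintype _).summable) hs').trans ?_
    have e : ∀ n, (∑' c : Finset.HasAntidiagonal.antidiagonal n,
        inner ℂ (a (Finset.HasAntidiagonal.sigmaAntidiagonalEquivProd ⟨n, c⟩).1)
          (a (Finset.HasAntidiagonal.sigmaAntidiagonalEquivProd ⟨n, c⟩).2)) =
        if n = 0 then inner ℂ (ψ : F) (ψ : F) else 0 := by
      intro n
      rw [tsum_fintype, ← h2 n]
      exact Finset.sum_coe_sort (Finset.HasAntidiagonal.antidiagonal n)
        (fun x => inner ℂ (a x.1) (a x.2))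
    exact (tsum_congr e).trans (tsum_ite_eq 0 _)
  rw [h4, inner_self_eq_norm_sq_to_K, inner_self_eq_norm_sq_to_K] at h1
  have h5 : ‖∑' k, a k‖ ^ 2 = ‖(ψ : F)‖ ^ 2 := by exact_mod_cast h1
  exact (pow_left_inj₀ (norm_nonneg _) (norm_nonneg _) two_ne_zero).1 h5

/-- A symmetric operator `A` on a dense invariant domain of vectors for which the exponential series
converges absolutely has a bounded exponential `e^{iA}`. -/
theorem exists_exp [CompleteSpace F] {D : Submodule ℂ F} (hD : Dense (D : Set F))
    (A : D →ₗ[ℂ] D)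
    (hA : ∀ ψ φ : D, inner ℂ ((A ψ : D) : F) (φ : F) = inner ℂ (ψ : F) ((A φ : D) : F))
    (hs : ∀ ψ, Summable fun k => ‖expTerm A ψ k‖) :
    ∃ W : F →L[ℂ] F, ∀ ψ : D, HasSum (expTerm A ψ) (W ψ) := by
  let S : D →ₗ[ℂ] F :=
    { toFun := fun ψ => ∑' k, expTerm A ψ k
      map_add' := fun a b => by
        rw [← (hs a).of_norm.tsum_add (hs b).of_norm]
        exact tsum_congr fun k => by simp [expTerm]
      map_smul' := fun c a => by
        rw [RingHom.id_apply, ← tsum_const_smul'' c]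
        exact tsum_congr fun k => by simp [expTerm, smul_comm c] }
  have hd : DenseRange D.subtype := by
    rw [DenseRange, ← LinearMap.coe_range, Submodule.range_subtype]; exact hD
  have hb : ∃ C : ℝ, ∀ ψ, ‖S ψ‖ ≤ C * ‖D.subtype ψ‖ :=
    ⟨1, fun ψ => by rw [one_mul]; exact (norm_tsum_expTerm hA ψ (hs ψ)).le⟩
  refine ⟨S.extendOfNorm D.subtype, fun ψ => ?_⟩
  have := LinearMap.extendOfNorm_eq hd hb ψ
  rw [Submodule.subtype_apply] at this
  rw [this]
  exact (hs ψ).of_norm.hasSum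

end Exponential
section Algebra

variable {F : Type*} [NormedAddCommGroup F] [InnerProductSpace ℂ F] [CompleteSpace F]

/-- The (unital) C*-algebra generated by a family of bounded operators: the norm closure of the
*-algebra generated by the family. -/
def generatedAlgebra {ι : Type*} (W : ι → F →L[ℂ] F) : StarSubalgebra ℂ (F →L[ℂ] F) :=
  (StarAlgebra.adjoin ℂ (Set.range W)).topologicalClosure

/-- A generator as an element of the generated C*-algebra. -/
def generator {ι : Type*} (W : ι → F →L[ℂ] F) (i : ι) : generatedAlgebra W :=
  ⟨W i, StarSubalgebra.le_topologicalClosure _ (StarAlgebra.subset_adjoin ℂ _ ⟨i, rfl⟩)⟩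

/-- A state on a C*-algebra of operators: a positive linear functional of norm one. -/
structure IsState {A : StarSubalgebra ℂ (F →L[ℂ] F)} (ω : A →L[ℂ] ℂ) : Prop where
  nonneg : ∀ B : A, 0 ≤ ω (star B * B)
  norm_eq_one : ‖ω‖ = 1

/-- The state `B ↦ ⟨Ψ, B Ψ⟩` given by a (normalized) vector `Ψ`. -/
def vectorFunctional {A : StarSubalgebra ℂ (F →L[ℂ] F)} (Ψ : F) (B : A) : ℂ :=
  inner ℂ Ψ ((B : F →L[ℂ] F) Ψ)

/-- `ω` is given by a normalized vector. On an algebra of operators on Fock space, such an `ω` is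
called a Fock state. -/
def IsVectorState {A : StarSubalgebra ℂ (F →L[ℂ] F)} (ω : A →L[ℂ] ℂ) : Prop :=
  ∃ Ψ : F, ‖Ψ‖ = 1 ∧ ∀ B : A, ω B = vectorFunctional Ψ B

end Algebra

section Fock
variable {H : Type*} [NormedAddCommGroup H] [InnerProductSpace ℂ H]

/-- The kernel `(f, g) ↦ ∏ i, ⟨f i, g i⟩` of the `n`-fold Hilbert tensor power: the inner product of two
elementary tensors. -/
def tensorKernel (H : Type*) [NormedAddCommGroup H] [InnerProductSpace ℂ H] (n : ℕ) :
    Matrix (Fin n → H) (Fin n → H) (ℂ →L[ℂ] ℂ) :=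
  fun f g => (∏ i, inner ℂ (f i) (g i)) • ContinuousLinearMap.id ℂ ℂ

theorem posSemidef_innerKernel {X : Type*} (u : X → H) :
    Matrix.PosSemidef (fun f g : X => inner ℂ (u f) (u g)) := by
  refine ⟨?_, fun x => ?_⟩
  · ext f g
    exact inner_conj_symm _ _
  · have : (x.sum fun i xi => x.sum fun j xj => star xi * inner ℂ (u i) (u j) * xj)
        = inner ℂ (x.sum fun i xi => xi • u i) (x.sum fun i xi => xi • u i) := by
      rw [Finsupp.sum, Finsupp.sum, sum_inner]
      refine Finset.sum_congr rfl fun i _ => ?_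
      rw [inner_sum]
      refine Finset.sum_congr rfl fun j _ => ?_
      simp only [inner_smul_left, inner_smul_right, starRingEnd_apply]; ring
    refine le_of_le_of_eq ?_ this.symm
    rw [inner_self_eq_norm_sq_to_K]
    have h0 : (0 : ℝ) ≤ ‖x.sum fun i xi => xi • u i‖ ^ 2 := sq_nonneg _
    rw [← RCLike.ofReal_pow]
    exact (RCLike.ofReal_nonneg (K := ℂ)).2 h0

theorem posSemidef_innerProd (H : Type*) [NormedAddCommGroup H] [InnerProductSpace ℂ H] (n : ℕ) :
    Matrix.PosSemidef (fun f g : Fin n → H => ∏ i, inner ℂ (f i) (g i)) := by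
  have key : ∀ s : Finset (Fin n),
      Matrix.PosSemidef (fun f g : Fin n → H => ∏ i ∈ s, inner ℂ (f i) (g i)) := by
    intro s
    induction s using Finset.induction_on with
    | empty =>
      have := posSemidef_innerKernel (fun _ : Fin n → H => (1 : ℂ))
      simpa using this
    | insert a s ha ih =>
      simp only [Finset.prod_insert ha]
      exact (posSemidef_innerKernel fun f : Fin n → H => f a).hadamard ih
  exact key Finset.univ

instance (n : ℕ) : Fact (tensorKernel H n).PosSemidef := ⟨by
  refine ((RKHS.posSemidef_tfae (K := tensorKernel H n)).out 0 2).mpr ?_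
  have h := posSemidef_innerProd H n
  refine ⟨?_, fun v => ?_⟩
  · ext f g
    have : (starRingEnd ℂ) (∏ i, inner ℂ (g i) (f i)) = ∏ i, inner ℂ (f i) (g i) := by
      rw [map_prod]; simp only [inner_conj_symm]
    rw [Matrix.conjTranspose_apply, tensorKernel, star_smul, ← starRingEnd_apply, this]
    simp [tensorKernel, ← ContinuousLinearMap.one_def]
  · have h3 := (Complex.nonneg_iff.1 (h.2 v)).1
    refine le_of_le_of_eq h3 ?_
    rw [RCLike.re_eq_complex_re]
    simp only [Finsupp.sum]
    congr 1
    refine Finset.sum_congr rfl fun x _ => ?_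
    refine Finset.sum_congr rfl fun y _ => ?_
    simp [tensorKernel]
    ring⟩


/-- The `n`-fold Hilbert tensor power of `H`: the completion of the linear combinations of elementary
tensors `f 0 ⊗ ⋯ ⊗ f (n - 1)` for the inner product determined by
`⟨f 0 ⊗ ⋯, g 0 ⊗ ⋯⟩ = ∏ i, ⟨f i, g i⟩` (see `inner_tprod` and `dense_tprod`). -/
def TensorPower (H : Type*) [NormedAddCommGroup H] [InnerProductSpace ℂ H] (n : ℕ) :=
  RKHS.OfKernel (tensorKernel H n)

instance (n : ℕ) : NormedAddCommGroup (TensorPower H n) :=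
  inferInstanceAs (NormedAddCommGroup (RKHS.OfKernel (tensorKernel H n)))

instance (n : ℕ) : InnerProductSpace ℂ (TensorPower H n) :=
  inferInstanceAs (InnerProductSpace ℂ (RKHS.OfKernel (tensorKernel H n)))

instance (n : ℕ) : CompleteSpace (TensorPower H n) :=
  inferInstanceAs (CompleteSpace (RKHS.OfKernel (tensorKernel H n)))

/-- The elementary tensor `f 0 ⊗ ⋯ ⊗ f (n - 1)`. -/
def tprod {n : ℕ} (f : Fin n → H) : TensorPower H n :=
  RKHS.kerFun (RKHS.OfKernel (tensorKernel H n)) f 1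

theorem inner_tprod {n : ℕ} (f g : Fin n → H) :
    inner ℂ (tprod f) (tprod g) = ∏ i, inner ℂ (f i) (g i) := by
  have h : inner ℂ (RKHS.kerFun (RKHS.OfKernel (tensorKernel H n)) f 1)
      (RKHS.kerFun (RKHS.OfKernel (tensorKernel H n)) g 1) = ∏ i, inner ℂ (f i) (g i) := by
    rw [RKHS.kerFun_inner, RKHS.kerFun_apply, RKHS.OfKernel.kernel_ofKernel]
    simp [tensorKernel]
  exact h

theorem dense_tprod (n : ℕ) :
    DenseRange (Finsupp.linearCombination ℂ (tprod : (Fin n → H) → TensorPower H n)) := by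
  have h := RKHS.kerFun_dense (RKHS.OfKernel (tensorKernel H n))
  rw [DenseRange, ← LinearMap.coe_range, Finsupp.range_linearCombination]
  rw [← Submodule.dense_iff_topologicalClosure_eq_top] at h
  refine h.mono ?_
  refine Submodule.span_le.2 ?_
  rintro _ ⟨f, c, rfl⟩
  have e := (RKHS.kerFun (RKHS.OfKernel (tensorKernel H n)) f).map_smul c (1 : ℂ)
  rw [smul_eq_mul, mul_one] at e
  rw [e]
  exact Submodule.smul_mem
    (Submodule.span ℂ (Set.range (tprod : (Fin n → H) → TensorPower H n))) c
    (Submodule.subset_span ⟨f, rfl⟩)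

/-- The bounded operator `ψ ↦ h ⊗ ψ` (see `tensorLeft_tprod`). -/
def tensorLeft (h : H) (n : ℕ) : TensorPower H n →L[ℂ] TensorPower H (n + 1) :=
  (Finsupp.linearCombination ℂ
    (fun f : Fin n → H => tprod (Fin.cons h f : Fin (n + 1) → H))).extendOfNorm
    (Finsupp.linearCombination ℂ (tprod : (Fin n → H) → TensorPower H n))

theorem norm_cons (h : H) (n : ℕ) (c : (Fin n → H) →₀ ℂ) :
    ‖Finsupp.linearCombination ℂ
      (fun f : Fin n → H => tprod (Fin.cons h f : Fin (n + 1) → H)) c‖ =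
    ‖h‖ * ‖Finsupp.linearCombination ℂ (tprod : (Fin n → H) → TensorPower H n) c‖ := by
  have key : inner ℂ (Finsupp.linearCombination ℂ
      (fun f : Fin n → H => tprod (Fin.cons h f : Fin (n + 1) → H)) c)
      (Finsupp.linearCombination ℂ
      (fun f : Fin n → H => tprod (Fin.cons h f : Fin (n + 1) → H)) c) =
      inner ℂ h h * inner ℂ
        (Finsupp.linearCombination ℂ (tprod : (Fin n → H) → TensorPower H n) c)
        (Finsupp.linearCombination ℂ (tprod : (Fin n → H) → TensorPower H n) c) := by
    simp only [Finsupp.linearCombination_apply, Finsupp.sum, sum_inner, inner_sum,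
      inner_smul_left, inner_smul_right, inner_tprod, Fin.prod_univ_succ, Fin.cons_zero,
      Fin.cons_succ, Finset.mul_sum]
    refine Finset.sum_congr rfl fun i _ => Finset.sum_congr rfl fun j _ => ?_
    ring
  rw [inner_self_eq_norm_sq_to_K, inner_self_eq_norm_sq_to_K, inner_self_eq_norm_sq_to_K,
    ← mul_pow] at key
  have key2 : ‖Finsupp.linearCombination ℂ
      (fun f : Fin n → H => tprod (Fin.cons h f : Fin (n + 1) → H)) c‖ ^ 2 =
    (‖h‖ * ‖Finsupp.linearCombination ℂ (tprod : (Fin n → H) → TensorPower H n) c‖) ^ 2 := by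
    exact_mod_cast key
  exact (pow_left_inj₀ (norm_nonneg _) (by positivity) two_ne_zero).1 key2

theorem tensorLeft_tprod (h : H) {n : ℕ} (f : Fin n → H) :
    tensorLeft h n (tprod f) = tprod (Fin.cons h f : Fin (n + 1) → H) := by
  have := LinearMap.extendOfNorm_eq (f := Finsupp.linearCombination ℂ
    (fun f : Fin n → H => tprod (Fin.cons h f : Fin (n + 1) → H))) (dense_tprod n)
    ⟨‖h‖, fun c => (norm_cons h n c).le⟩ (Finsupp.single f 1)
  simpa [tensorLeft] using this

/-- The `n`-fold symmetric tensor power: the closed subspace of the tensors that are invariant under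
permutations of the factors. -/
def symmetricPower (H : Type*) [NormedAddCommGroup H] [InnerProductSpace ℂ H] (n : ℕ) :
    Submodule ℂ (TensorPower H n) where
  carrier := {ψ | ∀ (σ : Equiv.Perm (Fin n)) (f : Fin n → H),
    inner ℂ (tprod (f ∘ σ)) ψ = inner ℂ (tprod f) ψ}
  zero_mem' := by simp
  add_mem' := by
    intro a b ha hb σ f
    rw [inner_add_right, inner_add_right, ha, hb]
  smul_mem' := by
    intro c a ha σ f
    rw [inner_smul_right, inner_smul_right, ha]

instance (n : ℕ) : CompleteSpace (symmetricPower H n) := by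
  refine IsClosed.completeSpace_coe (s := (symmetricPower H n : Set (TensorPower H n))) (hs := ?_)
  have : (symmetricPower H n : Set (TensorPower H n)) =
      ⋂ (σ : Equiv.Perm (Fin n)) (f : Fin n → H),
        {ψ | inner ℂ (tprod (f ∘ σ)) ψ = inner ℂ (tprod f) ψ} := by
    ext ψ; simp [symmetricPower]
  rw [this]
  exact isClosed_iInter fun σ => isClosed_iInter fun f =>
    isClosed_eq (by fun_prop) (by fun_prop)

/-- The Hilbert direct sum of the symmetric tensor powers of `H`. -/
abbrev FockSum (H : Type*) [NormedAddCommGroup H] [InnerProductSpace ℂ H] :=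
  lp (fun n => symmetricPower H n) 2

/-- The creation operator on `n`-particle vectors, `ψ ↦ √(n+1) Sym (h ⊗ ψ)`, with `Sym` the orthogonal
projection onto the symmetric tensors. It is linear in `h`. -/
def create (h : H) (n : ℕ) : symmetricPower H n →L[ℂ] symmetricPower H (n + 1) :=
  ((Real.sqrt (n + 1) : ℝ) : ℂ) •
    ((symmetricPower H (n + 1)).orthogonalProjectionOnto ∘L tensorLeft h n ∘L
      (symmetricPower H n).subtypeL)

/-- The annihilation operator on `n+1`-particle vectors, the adjoint of the creation operator. It is
antilinear in `h`. -/
def annihilate (h : H) (n : ℕ) : symmetricPower H (n + 1) →L[ℂ] symmetricPower H n :=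
  ContinuousLinearMap.adjoint (create h n)

/-- The dense domain of the vectors with a finite number of particles. -/
def finiteParticle (H : Type*) [NormedAddCommGroup H] [InnerProductSpace ℂ H] :
    Submodule ℂ (FockSum H) where
  carrier := {ψ | ∃ N : ℕ, ∀ n, N ≤ n → ψ n = 0}
  zero_mem' := ⟨0, fun _ _ => rfl⟩
  add_mem' := by
    rintro a b ⟨M, hM⟩ ⟨N, hN⟩
    refine ⟨max M N, fun n hn => ?_⟩
    rw [lp.coeFn_add, Pi.add_apply, hM n (le_of_max_le_left hn), hN n (le_of_max_le_right hn),
      add_zero]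
  smul_mem' := by
    rintro c a ⟨N, hN⟩
    refine ⟨N, fun n hn => ?_⟩
    rw [lp.coeFn_smul, Pi.smul_apply, hN n hn, smul_zero]

/-- A finite sequence of `n`-particle vectors as an element of the finite particle domain. -/
def mkFinite (φ : ∀ n, symmetricPower H n) (hφ : ∃ N : ℕ, ∀ n, N ≤ n → φ n = 0) :
    finiteParticle H :=
  ⟨⟨φ, by
    obtain ⟨N, hN⟩ := hφ
    refine (memℓp_zero ?_).of_exponent_ge (zero_le (a := (2 : ℝ≥0∞)))
    refine (Set.finite_lt_nat N).subset fun n hn => ?_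
    by_contra h
    exact hn (hN n (not_lt.1 h))⟩, hφ⟩

/-- The creation operator `a*(h)` on the finite particle domain. -/
def createOp (h : H) : finiteParticle H →ₗ[ℂ] finiteParticle H where
  toFun ψ := mkFinite
    (fun n => match n with
      | 0 => 0
      | n + 1 => create h n (ψ.1 n)) (by
    obtain ⟨N, hN⟩ := ψ.2
    refine ⟨N + 1, fun n hn => ?_⟩
    match n, hn with
    | n + 1, hn =>
      have := hN n (by omega)
      simp only [this, map_zero])
  map_add' a b := by
    refine Subtype.ext (lp.ext (funext fun n => ?_))
    match n with
    | 0 => exact (add_zero _).symm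
    | n + 1 => exact map_add (create h n) _ _
  map_smul' c a := by
    refine Subtype.ext (lp.ext (funext fun n => ?_))
    match n with
    | 0 => exact (smul_zero c).symm
    | n + 1 => exact map_smul (create h n) c _

/-- The annihilation operator `a(h)` on the finite particle domain. -/
def annihilateOp (h : H) : finiteParticle H →ₗ[ℂ] finiteParticle H where
  toFun ψ := mkFinite (fun n => annihilate h n (ψ.1 (n + 1))) (by
    obtain ⟨N, hN⟩ := ψ.2
    refine ⟨N, fun n hn => ?_⟩
    rw [hN (n + 1) (by omega), map_zero])
  map_add' a b := by
    refine Subtype.ext (lp.ext (funext fun n => ?_))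
    exact map_add (annihilate h n) _ _
  map_smul' c a := by
    refine Subtype.ext (lp.ext (funext fun n => ?_))
    exact map_smul (annihilate h n) c _

/-- The field operator `A(h) = (a*(h) + a(h)) / √2` on the finite particle domain. -/
def fieldOp (h : H) : finiteParticle H →ₗ[ℂ] finiteParticle H :=
  ((1 / Real.sqrt 2 : ℝ) : ℂ) • (createOp h + annihilateOp h)


theorem norm_tensorLeft_le (h : H) (n : ℕ) (ψ : TensorPower H n) :
    ‖tensorLeft h n ψ‖ ≤ ‖h‖ * ‖ψ‖ :=
  LinearMap.norm_extendOfNorm_apply_le (dense_tprod n) _ (fun c => (norm_cons h n c).le) ψ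

theorem norm_create_le (h : H) (n : ℕ) : ‖create h n‖ ≤ Real.sqrt (n + 1) * ‖h‖ := by
  refine ContinuousLinearMap.opNorm_le_bound _ (by positivity) fun ψ => ?_
  rw [create, smul_apply, norm_smul, Complex.norm_real,
    Real.norm_of_nonneg (Real.sqrt_nonneg _), mul_assoc]
  refine mul_le_mul_of_nonneg_left ?_ (Real.sqrt_nonneg _)
  exact ((symmetricPower H (n + 1)).norm_orthogonalProjectionOnto_apply_le _).trans
    (norm_tensorLeft_le h n ψ)

theorem norm_annihilate_le (h : H) (n : ℕ) : ‖annihilate h n‖ ≤ Real.sqrt (n + 1) * ‖h‖ := by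
  rw [annihilate, LinearIsometryEquiv.norm_map]
  exact norm_create_le h n

theorem createOp_apply_zero (h : H) (ψ : finiteParticle H) : (createOp h ψ).1 0 = 0 := rfl

theorem createOp_apply_succ (h : H) (ψ : finiteParticle H) (n : ℕ) :
    (createOp h ψ).1 (n + 1) = create h n (ψ.1 n) := rfl

theorem annihilateOp_apply (h : H) (ψ : finiteParticle H) (n : ℕ) :
    (annihilateOp h ψ).1 n = annihilate h n (ψ.1 (n + 1)) := rfl

theorem inner_createOp (h : H) (ψ φ : finiteParticle H) :
    inner ℂ (createOp h ψ).1 φ.1 = inner ℂ ψ.1 (annihilateOp h φ).1 := by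
  have h1 := lp.inner_eq_tsum (𝕜 := ℂ) (createOp h ψ).1 φ.1
  have h2 := lp.inner_eq_tsum (𝕜 := ℂ) ψ.1 (annihilateOp h φ).1
  have h3 := (lp.summable_inner (𝕜 := ℂ) (createOp h ψ).1 φ.1).tsum_eq_zero_add
  rw [createOp_apply_zero, inner_zero_left, zero_add] at h3
  refine h1.trans (h3.trans (Eq.trans (tsum_congr fun n => ?_) h2.symm))
  rw [createOp_apply_succ, annihilateOp_apply, annihilate,
    ContinuousLinearMap.adjoint_inner_right]

theorem inner_fieldOp (h : H) (ψ φ : finiteParticle H) :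
    inner ℂ (fieldOp h ψ).1 φ.1 = inner ℂ ψ.1 (fieldOp h φ).1 := by
  have key2 : inner ℂ (annihilateOp h ψ).1 φ.1 = inner ℂ ψ.1 (createOp h φ).1 := by
    rw [← inner_conj_symm, ← inner_createOp, inner_conj_symm]
  have e : ∀ χ : finiteParticle H, (fieldOp h χ).1 =
      ((1 / Real.sqrt 2 : ℝ) : ℂ) • ((createOp h χ).1 + (annihilateOp h χ).1) := fun _ => rfl
  rw [e, e, inner_smul_left, inner_smul_right, inner_add_left, inner_add_right, inner_createOp,
    key2, Complex.conj_ofReal, add_comm]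

theorem dense_finiteParticle : Dense (finiteParticle H : Set (FockSum H)) := by
  intro ψ
  have hs := lp.hasSum_single (by norm_num : (2 : ℝ≥0∞) ≠ ∞) ψ
  refine mem_closure_of_tendsto hs (Filter.Eventually.of_forall fun s => ?_)
  refine Submodule.sum_mem _ fun i _ => ?_
  refine ⟨i + 1, fun n hn => ?_⟩
  rw [lp.single_apply_ne]
  omega

/-- The sum of the norms of the first `N` components. -/
def partialNorm (N : ℕ) (ψ : FockSum H) : ℝ := ∑ n ∈ Finset.range N, ‖ψ n‖

theorem norm_le_partialNorm {N : ℕ} {ψ : FockSum H} (hψ : ∀ n, N ≤ n → ψ n = 0) :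
    ‖ψ‖ ≤ partialNorm N ψ := by
  have hs := lp.hasSum_single (by norm_num : (2 : ℝ≥0∞) ≠ ∞) ψ
  have he := hs.unique (hasSum_sum_of_ne_finset_zero (s := Finset.range N) fun n hn => by
    rw [hψ n (by simpa using hn)]; exact map_zero (lp.singleAddMonoidHom (E := fun n => symmetricPower H n) 2 n))
  conv_lhs => rw [he]
  refine (norm_sum_le _ _).trans (Finset.sum_le_sum fun n _ => ?_)
  rw [lp.norm_single (by norm_num)]

theorem fieldOp_apply_zero (h : H) (ψ : finiteParticle H) :
    (fieldOp h ψ).1 0 = ((1 / Real.sqrt 2 : ℝ) : ℂ) • (0 + annihilate h 0 (ψ.1 1)) := rfl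

theorem fieldOp_apply_succ (h : H) (ψ : finiteParticle H) (n : ℕ) :
    (fieldOp h ψ).1 (n + 1) = ((1 / Real.sqrt 2 : ℝ) : ℂ) •
      (create h n (ψ.1 n) + annihilate h (n + 1) (ψ.1 (n + 2))) := rfl

theorem fieldOp_support (h : H) {N : ℕ} {ψ : finiteParticle H}
    (hψ : ∀ n, N ≤ n → ψ.1 n = 0) : ∀ n, N + 1 ≤ n → (fieldOp h ψ).1 n = 0 := by
  intro n hn
  match n, hn with
  | n + 1, hn =>
    rw [fieldOp_apply_succ, hψ n (by omega), hψ (n + 2) (by omega)]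
    simp

theorem partialNorm_fieldOp (h : H) {N : ℕ} {ψ : finiteParticle H}
    (hψ : ∀ n, N ≤ n → ψ.1 n = 0) :
    partialNorm (N + 1) (fieldOp h ψ).1 ≤ 2 * ‖h‖ * Real.sqrt (N + 1) * partialNorm N ψ.1 := by
  have hr : ‖((1 / Real.sqrt 2 : ℝ) : ℂ)‖ ≤ 1 := by
    rw [Complex.norm_real, Real.norm_of_nonneg (by positivity)]
    rw [div_le_one (by positivity)]
    exact Real.one_le_sqrt.2 (by norm_num)
  set C := Real.sqrt (N + 1) * ‖h‖ with hC
  have hC0 : 0 ≤ C := by positivity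
  have hc : ∀ n, ‖create h n (ψ.1 n)‖ ≤ C * ‖ψ.1 n‖ := by
    intro n
    by_cases hn : N ≤ n
    · rw [hψ n hn]; simp
    · refine (ContinuousLinearMap.le_of_opNorm_le _ (norm_create_le h n) _).trans ?_
      have : Real.sqrt (n + 1) ≤ Real.sqrt (N + 1) := by
        refine Real.sqrt_le_sqrt ?_
        have : (n : ℝ) ≤ N := by exact_mod_cast (not_le.1 hn).le
        linarith
      rw [hC]
      gcongr
  have ha : ∀ n, ‖annihilate h n (ψ.1 (n + 1))‖ ≤ C * ‖ψ.1 (n + 1)‖ := by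
    intro n
    by_cases hn : N ≤ n + 1
    · rw [hψ _ hn]; simp
    · refine (ContinuousLinearMap.le_of_opNorm_le _ (norm_annihilate_le h n) _).trans ?_
      have : Real.sqrt (n + 1) ≤ Real.sqrt (N + 1) := by
        refine Real.sqrt_le_sqrt ?_
        have : (n : ℝ) ≤ N := by exact_mod_cast (by omega : n ≤ N)
        linarith
      rw [hC]
      gcongr
  have hsum : ∀ M, N ≤ M → ∑ n ∈ Finset.range M, ‖ψ.1 n‖ = partialNorm N ψ.1 := by
    intro M hM
    refine (Finset.sum_subset (by simpa using hM) fun n _ hn => ?_).symm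
    rw [hψ n (by simpa using hn), norm_zero]
  have h1 : ∑ n ∈ Finset.range (N + 1), ‖ψ.1 (n + 1)‖ ≤ partialNorm N ψ.1 := by
    rw [← hsum (N + 2) (by omega), Finset.sum_range_succ' _ (N + 1)]
    exact le_add_of_nonneg_right (norm_nonneg _)
  have h2 : ∑ n ∈ Finset.range N, ‖ψ.1 (n + 2)‖ + ‖ψ.1 1‖ ≤ partialNorm N ψ.1 := by
    rw [← Finset.sum_range_succ' (fun n => ‖ψ.1 (n + 1)‖)]
    exact h1
  rw [partialNorm, Finset.sum_range_succ']
  have h3 : ∀ n, ‖(fieldOp h ψ).1 (n + 1)‖ ≤ C * ‖ψ.1 n‖ + C * ‖ψ.1 (n + 2)‖ := by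
    intro n
    rw [fieldOp_apply_succ, norm_smul]
    refine (mul_le_of_le_one_left (norm_nonneg _) hr).trans ?_
    exact (norm_add_le _ _).trans (add_le_add (hc n) (ha (n + 1)))
  have h4 : ‖(fieldOp h ψ).1 0‖ ≤ C * ‖ψ.1 1‖ := by
    rw [fieldOp_apply_zero, norm_smul, zero_add]
    exact (mul_le_of_le_one_left (norm_nonneg _) hr).trans (ha 0)
  calc _ ≤ ∑ n ∈ Finset.range N, (C * ‖ψ.1 n‖ + C * ‖ψ.1 (n + 2)‖) + C * ‖ψ.1 1‖ :=
        add_le_add (Finset.sum_le_sum fun n _ => h3 n) h4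
    _ = C * partialNorm N ψ.1 + C * (∑ n ∈ Finset.range N, ‖ψ.1 (n + 2)‖ + ‖ψ.1 1‖) := by
        rw [Finset.sum_add_distrib, ← Finset.mul_sum, ← Finset.mul_sum, partialNorm]; ring
    _ ≤ C * partialNorm N ψ.1 + C * partialNorm N ψ.1 := by gcongr
    _ = _ := by rw [hC]; ring

theorem summable_expTerm_fieldOp (h : H) (ψ : finiteParticle H) :
    Summable fun k => ‖expTerm (fieldOp h) ψ k‖ := by
  obtain ⟨N, hN⟩ := ψ.2
  let r : ℕ → ℝ := fun j => 2 * ‖h‖ * Real.sqrt ((N + j : ℕ) + 1) / (j + 1)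
  have hr0 : ∀ j, 0 ≤ r j := fun j => by positivity
  let B : ℕ → ℝ := fun k => ∏ j ∈ Finset.range k, r j
  have hB0 : ∀ k, 0 ≤ B k := fun k => Finset.prod_nonneg fun j _ => hr0 j
  have hsupp : ∀ k, (∀ n, N + k ≤ n → ((fieldOp h ^ k) ψ).1 n = 0) ∧
      partialNorm (N + k) ((fieldOp h ^ k) ψ).1 ≤ k.factorial * B k * partialNorm N ψ.1 := by
    intro k
    induction k with
    | zero => simpa [B] using hN
    | succ k ih =>
      rw [pow_succ', Module.End.mul_apply, ← add_assoc]
      refine ⟨fieldOp_support h ih.1, (partialNorm_fieldOp h ih.1).trans ?_⟩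
      have e : ((k + 1).factorial : ℝ) * B (k + 1) =
          2 * ‖h‖ * Real.sqrt ((N + k : ℕ) + 1) * (k.factorial * B k) := by
        simp only [B, Finset.prod_range_succ, r, Nat.factorial_succ]
        push_cast
        field_simp
      rw [e, mul_assoc _ _ (partialNorm N ψ.1)]
      exact mul_le_mul_of_nonneg_left ih.2 (by positivity)
  have hbound : ∀ k, ‖expTerm (fieldOp h) ψ k‖ ≤ B k * partialNorm N ψ.1 := by
    intro k
    have f : (0 : ℝ) < k.factorial := by exact_mod_cast k.factorial_pos
    rw [expTerm, norm_smul, norm_div, norm_pow, Complex.norm_I, one_pow, Complex.norm_natCast,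
      div_mul_eq_mul_div, one_mul, div_le_iff₀ f]
    refine ((norm_le_partialNorm (hsupp k).1).trans (hsupp k).2).trans (le_of_eq ?_)
    ring
  have hlim : Filter.Tendsto r Filter.atTop (nhds 0) := by
    have h1 : Filter.Tendsto (fun j : ℕ => 2 * ‖h‖ * Real.sqrt (N + 1) *
        (1 / Real.sqrt ((j : ℝ) + 1))) Filter.atTop (nhds 0) := by
      have : Filter.Tendsto (fun j : ℕ => Real.sqrt ((j : ℝ) + 1)) Filter.atTop Filter.atTop :=
        Real.tendsto_sqrt_atTop.comp
          (Filter.tendsto_atTop_add_const_right _ _ tendsto_natCast_atTop_atTop)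
      simpa using (this.inv_tendsto_atTop).const_mul (2 * ‖h‖ * Real.sqrt (N + 1))
    refine squeeze_zero hr0 (fun j => ?_) h1
    have hj : (0 : ℝ) < (j : ℝ) + 1 := by positivity
    have hs : Real.sqrt ((N + j : ℕ) + 1) ≤ Real.sqrt (N + 1) * Real.sqrt ((j : ℝ) + 1) := by
      rw [← Real.sqrt_mul (by positivity)]
      refine Real.sqrt_le_sqrt ?_
      push_cast
      nlinarith [mul_nonneg (Nat.cast_nonneg (α := ℝ) N) (Nat.cast_nonneg (α := ℝ) j)]
    have hq : Real.sqrt ((j : ℝ) + 1) / ((j : ℝ) + 1) = 1 / Real.sqrt ((j : ℝ) + 1) :=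
      Real.sqrt_div_self'
    calc r j ≤ 2 * ‖h‖ * (Real.sqrt (N + 1) * Real.sqrt ((j : ℝ) + 1)) / ((j : ℝ) + 1) := by
          simp only [r]; gcongr
      _ = _ := by rw [← hq]; ring
  have hBs : Summable B := by
    refine summable_of_ratio_norm_eventually_le (r := 1 / 2) (by norm_num) ?_
    filter_upwards [hlim.eventually (ge_mem_nhds (by norm_num : (0 : ℝ) < 1 / 2))] with k hk
    simp only [B, Finset.prod_range_succ, norm_mul]
    rw [mul_comm, Real.norm_of_nonneg (hr0 k)]
    exact mul_le_mul_of_nonneg_right hk (norm_nonneg _)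
  exact (hBs.mul_right _).of_nonneg_of_le (fun k => norm_nonneg _) hbound

theorem exists_weyl (h : H) : ∃ W : FockSum H →L[ℂ] FockSum H,
    ∀ ψ : finiteParticle H, HasSum (expTerm (fieldOp h) ψ) (W ψ) :=
  exists_exp dense_finiteParticle (fieldOp h) (inner_fieldOp h) (summable_expTerm_fieldOp h)

/-- The symmetric Fock space over `H`: the Hilbert direct sum of the symmetric tensor powers, as a
type of its own. -/
def FockSpace (H : Type*) [NormedAddCommGroup H] [InnerProductSpace ℂ H] := FockSum H

instance : NormedAddCommGroup (FockSpace H) := inferInstanceAs (NormedAddCommGroup (FockSum H))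

instance : InnerProductSpace ℂ (FockSpace H) := inferInstanceAs (InnerProductSpace ℂ (FockSum H))

instance : CompleteSpace (FockSpace H) := inferInstanceAs (CompleteSpace (FockSum H))

/-- The Weyl operator `W(h) = e^{i A(h)}`: the unique bounded operator that on every vector of the (dense)
finite particle domain is the sum of the exponential series of `i A(h)` (see `hasSum_weyl`). -/
def weyl (h : H) : FockSpace H →L[ℂ] FockSpace H := (exists_weyl h).choose

theorem hasSum_weyl (h : H) (ψ : finiteParticle H) :
    HasSum (expTerm (fieldOp h) ψ) (weyl h ψ.1) := (exists_weyl h).choose_spec ψ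

theorem tprod_mem_symmetricPower_zero (f : Fin 0 → H) : tprod f ∈ symmetricPower H 0 := by
  intro σ g
  rw [Subsingleton.elim (g ∘ σ) g]

/-- The Fock vacuum. -/
def vacuum (H : Type*) [NormedAddCommGroup H] [InnerProductSpace ℂ H] : FockSpace H :=
  lp.single (E := fun n => symmetricPower H n) 2 0
    ⟨tprod Fin.elim0, tprod_mem_symmetricPower_zero _⟩

/-- The Weyl algebra over `S`: the C*-algebra of operators on Fock space generated by the Weyl
operators `W(h)`, `h ∈ S`. -/
abbrev weylAlgebra (S : Set H) : StarSubalgebra ℂ (FockSpace H →L[ℂ] FockSpace H) :=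
  generatedAlgebra (F := FockSpace H) fun h : S => weyl (h : H)

/-- The Weyl operator `W(h)`, `h ∈ S`, as an element of the Weyl algebra over `S`. -/
abbrev weylElement {S : Set H} (h : S) : weylAlgebra S :=
  generator (F := FockSpace H) (fun h : S => weyl (h : H)) h

/-- A Fock state: a functional on the Weyl algebra given by a normalized vector in Fock space. -/
def IsFockState {S : Set H} (ω : weylAlgebra S →L[ℂ] ℂ) : Prop :=
  IsVectorState (F := FockSpace H) ω

/-- `ω` is the state on the Weyl algebra over `S` with `ω(W(h)) = ω_0(W(h)) e^{i √2 Re L(h)}` for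
`h ∈ S`, where `ω_0` is the Fock vacuum. For linear `L` this is a coherent state. -/
structure IsCoherentState {S : Set H} (L : S → ℂ) (ω : weylAlgebra S →L[ℂ] ℂ) : Prop where
  isState : IsState (F := FockSpace H) ω
  apply_weyl : ∀ h : S, ω (weylElement h) =
    vectorFunctional (F := FockSpace H) (vacuum H) (weylElement h) *
      Complex.exp (Complex.I * ((Real.sqrt 2 * (L h).re : ℝ) : ℂ))

end Fock

section Photon

/-- Position space and momentum space `ℝ³`. -/
abbrev Space := EuclideanSpace ℝ (Fin 3)

/-- Complex vectors `ℂ³`. -/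
abbrev CVec := EuclideanSpace ℂ (Fin 3)

/-- The measure `dp / (2 ω(p))` on momentum space, with `ω(p) = |p|`. -/
def photonMeasure : Measure Space :=
  volume.withDensity fun p => ENNReal.ofReal (1 / (2 * ‖p‖))

/-- The transverse functions, `p · h(p) = 0`, in `L²(ℝ³, dp / (2 ω); ℂ³)`. -/
def transverseFunctions : Submodule ℂ (Lp CVec 2 photonMeasure) where
  carrier := {h | ∀ᵐ p ∂photonMeasure, ∑ k, (p k : ℂ) * h p k = 0}
  zero_mem' := by
    filter_upwards [Lp.coeFn_zero CVec 2 photonMeasure] with p hp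
    have h0 : (((0 : Lp CVec 2 photonMeasure) : Space → CVec)) p = 0 := hp
    refine Finset.sum_eq_zero fun k _ => ?_
    rw [h0]
    simp
  add_mem' := by
    intro a b ha hb
    filter_upwards [ha, hb, Lp.coeFn_add a b] with p h1 h2 h3
    simp only [h3, Pi.add_apply, PiLp.add_apply, mul_add, Finset.sum_add_distrib, h1, h2, add_zero]
  smul_mem' := by
    intro c a ha
    filter_upwards [ha, Lp.coeFn_smul c a] with p h1 h2
    simp only [h2, Pi.smul_apply, PiLp.smul_apply, smul_eq_mul, mul_left_comm _ c,
      ← Finset.mul_sum, h1, mul_zero]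

/-- The one photon Hilbert space: the space of transverse functions in `L²(ℝ³, dp / (2 ω); ℂ³)`. -/
def OnePhotonSpace : Type := transverseFunctions

instance : NormedAddCommGroup OnePhotonSpace :=
  inferInstanceAs (NormedAddCommGroup transverseFunctions)

instance : InnerProductSpace ℂ OnePhotonSpace :=
  inferInstanceAs (InnerProductSpace ℂ transverseFunctions)

/-- A representative of an element of the one photon space. -/
def OnePhotonSpace.toFun (h : OnePhotonSpace) : Space → CVec :=
  (Subtype.val (p := fun g => g ∈ transverseFunctions) h : Lp CVec 2 photonMeasure)

/-- The rapidly decreasing functions in the one photon space. -/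
def rapidlyDecreasing : Set OnePhotonSpace :=
  {h | ∀ k : ℕ, ∃ C : ℝ, ∀ᵐ p ∂photonMeasure,
    ‖h.toFun p‖ ≤ C * ((1 + ‖p‖ ^ 2) ^ k)⁻¹}

/-- The transverse projection `P(p) v`, with matrix `δ_{jk} - p_j p_k / |p|²`. -/
def transverseProj (p : Space) (v : CVec) : CVec :=
  WithLp.toLp 2 fun j => ∑ k,
    (((if j = k then 1 else 0) - p j * p k / ‖p‖ ^ 2 : ℝ) : ℂ) * v k

/-- The function `J(p) = - i (2π)^{-3/2} ∫ x'(s) e^{i ω(p) s - i p · x(s)} ds` of the current of a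
point charge with trajectory `x`. -/
def current (x : ℝ → Space) (p : Space) : CVec :=
  WithLp.toLp 2 fun k => -Complex.I * (((2 * Real.pi) ^ (-(3 / 2) : ℝ) : ℝ) : ℂ) *
    ∫ s : ℝ, (deriv x s k : ℂ) *
      Complex.exp (Complex.I * ((‖p‖ * s - inner ℝ p (x s) : ℝ) : ℂ))

/-- The transverse part `J_T(p) = P(p) J(p)`. -/
def transverseCurrent (x : ℝ → Space) (p : Space) : CVec :=
  transverseProj p (current x p)

/-- The pairing `(J_T, h) = ∫ conj J_T(p) · h(p) dp / (2 ω)`, which does not require `J_T` to be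
square integrable. -/
def currentPairing (x : ℝ → Space) (h : OnePhotonSpace) : ℂ :=
  ∫ p, inner ℂ (transverseCurrent x p) (h.toFun p) ∂photonMeasure

/-- A function of the momentum, up to equality almost everywhere, belongs to the one photon
space. -/
def MemOnePhotonSpace (J : Space → CVec) : Prop :=
  ∃ h : OnePhotonSpace, h.toFun =ᵐ[photonMeasure] J

/-- The algebra of the fields: the Weyl algebra over the rapidly decreasing functions. -/
abbrev fieldAlgebra : StarSubalgebra ℂ
    (FockSpace OnePhotonSpace →L[ℂ] FockSpace OnePhotonSpace) :=
  weylAlgebra rapidlyDecreasing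

/-- `ω` is the out-state of the trajectory `x`: the coherent state on the algebra of the fields with
`ω(W(h)) = ω_in(W(h)) e^{i √2 Re (J_T, h)}`, where `ω_in` is the Fock vacuum. -/
def IsOutState (x : ℝ → Space) (ω : fieldAlgebra →L[ℂ] ℂ) : Prop :=
  IsCoherentState (S := rapidlyDecreasing) (fun h => currentPairing x h) ω

end Photon

end PhotonField

end

/-! Coherent vectors drive both halves. The Weyl relation `weyl_mul_weyl` gives W(f)* W(h) W(f) =
e^{i Im (f, h)} W(h), so for J in the one-photon space and f = -i√2 J the vector W(f)Ω₀ produces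
exactly the factor e^{i√2 Re (J, h)} (`vectorFunctional_coherentVector`). If J_T lies in the
one-photon space, its coherent vector represents the out-state.

In general J_T is only measurable, bounded and transverse. Its cut-offs J_n to |p| ≤ n are square
integrable, because dp/(2ω) is finite on balls, and (J_n, h) → (J_T, h) for rapidly decreasing h. A
limit along an ultrafilter of the vector states of the J_n is therefore a state with the required
values (`exists_isCoherentState`). It is unique because the Weyl relation makes the linear span of
the W(h) a *-algebra, dense in the generated C*-algebra (`eq_of_eq_on_generators`).

Conversely, let Ψ represent the out-state. Since h ↦ W(h) is strongly continuous at 0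
(`tendsto_weyl`), the expectations of W(h) in Ψ and in Ω₀ are both near 1 for small ‖h‖, hence so is
the phase e^{i√2 Re (J_T, h)}. A large angle could be scaled down to π, where the phase is -1; thus
|Re (J_T, h)| ≤ C‖h‖. The J_n are themselves rapidly decreasing, and h = J_n gives ‖J_n‖² ≤ C‖J_n‖.
Fatou's lemma then makes J_T square integrable.

The Weyl relation needs care because W(h) is given by its exponential series only on finite particle
vectors, and W(g)ψ is no longer one. It is proved weakly, with one exponential moved to the other
side of the inner product; the resulting absolutely convergent double series is summed degree by
degree by `sum_divPow_mul_divPow`. -/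

noncomputable section

namespace PhotonField

open MeasureTheory
open scoped ComplexOrder ENNReal

/-! ### Creation and annihilation on symmetrized elementary tensors -/

section SymmetricTensors
variable {H : Type*} [NormedAddCommGroup H] [InnerProductSpace ℂ H]

/-- The symmetrized elementary tensor. -/
def symTensor {n : ℕ} (f : Fin n → H) : symmetricPower H n :=
  (symmetricPower H n).orthogonalProjectionOnto (tprod f)

theorem inner_symTensor_left {n : ℕ} (f : Fin n → H) (ψ : symmetricPower H n) :
    inner ℂ (symTensor f) ψ = inner ℂ (tprod f) (ψ : TensorPower H n) :=
  Submodule.inner_orthogonalProjectionOnto_eq_of_mem_right ψ (tprod f)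

theorem symTensor_comp {n : ℕ} (f : Fin n → H) (σ : Equiv.Perm (Fin n)) :
    symTensor (f ∘ σ) = symTensor f := by
  refine ext_inner_right ℂ fun ψ => ?_
  rw [inner_symTensor_left, inner_symTensor_left]
  exact ψ.2 σ f

/-- The average over permutations is symmetric, and against a symmetric ψ each of its n! terms has
the same inner product as `tprod f`; so it is the orthogonal projection. -/
theorem coe_symTensor {n : ℕ} (f : Fin n → H) :
    (symTensor f : TensorPower H n) =
      ((n.factorial : ℂ)⁻¹) • ∑ σ : Equiv.Perm (Fin n), tprod (f ∘ σ) := by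
  have hmem : ((n.factorial : ℂ)⁻¹) • ∑ σ : Equiv.Perm (Fin n), tprod (f ∘ σ) ∈
      symmetricPower H n := by
    refine Submodule.smul_mem _ _ fun τ g => ?_
    rw [inner_sum, inner_sum]
    refine (Fintype.sum_equiv (Equiv.mulRight τ) _ _ fun σ => ?_).symm
    rw [inner_tprod, inner_tprod]
    exact Fintype.prod_equiv τ.symm _ _ fun i => by simp
  suffices h : symTensor f = ⟨_, hmem⟩ from congrArg Subtype.val h
  refine ext_inner_right ℂ fun ψ => ?_
  rw [inner_symTensor_left, Submodule.coe_inner, inner_smul_left, sum_inner,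
    Finset.sum_congr rfl fun σ _ => ψ.2 σ f, Finset.sum_const, Finset.card_univ,
    Fintype.card_perm, Fintype.card_fin, nsmul_eq_mul, map_inv₀, map_natCast, ← mul_assoc,
    inv_mul_cancel₀ (by exact_mod_cast n.factorial_ne_zero), one_mul]

theorem inner_symTensor {n : ℕ} (f g : Fin n → H) :
    inner ℂ (symTensor f) (symTensor g) =
      (n.factorial : ℂ)⁻¹ * ∑ σ : Equiv.Perm (Fin n), ∏ i, inner ℂ (f i) (g (σ i)) := by
  rw [inner_symTensor_left, coe_symTensor, inner_smul_right, inner_sum]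
  simp only [inner_tprod, Function.comp_apply]

/-- A symmetric tensor orthogonal to every `symTensor f` is orthogonal to every `tprod f`, and these
are total. Identities between bounded operators can thus be checked on `symTensor f`. -/
theorem dense_span_symTensor (n : ℕ) :
    Dense (Submodule.span ℂ (Set.range (symTensor : (Fin n → H) → symmetricPower H n)) :
      Set (symmetricPower H n)) := by
  rw [Submodule.dense_iff_topologicalClosure_eq_top, Submodule.topologicalClosure_eq_top_iff,
    Submodule.eq_bot_iff]
  intro ψ hψ
  have h0 : ∀ f, inner ℂ (tprod f) (ψ : TensorPower H n) = 0 := fun f => by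
    rw [← inner_symTensor_left]
    exact hψ _ (Submodule.subset_span ⟨f, rfl⟩)
  refine Subtype.ext ((dense_tprod (H := H) n).eq_zero_of_inner_right (𝕜 := ℂ) ?_)
  intro c
  simp only [Finsupp.linearCombination_apply, Finsupp.sum, sum_inner, inner_smul_left, h0,
    mul_zero, Finset.sum_const_zero]

theorem ext_symTensor {n : ℕ} {E : Type*} [NormedAddCommGroup E] [NormedSpace ℂ E]
    {A B : symmetricPower H n →L[ℂ] E} (h : ∀ f, A (symTensor f) = B (symTensor f)) : A = B :=
  ContinuousLinearMap.ext_on (dense_span_symTensor n) (by rintro _ ⟨f, rfl⟩; exact h f)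

theorem ext_inner_symTensor {n : ℕ} {ψ φ : symmetricPower H n}
    (h : ∀ f, inner ℂ (symTensor f) ψ = inner ℂ (symTensor f) φ) : ψ = φ := by
  have := ext_symTensor (A := innerSL ℂ ψ) (B := innerSL ℂ φ) fun f => by
    rw [innerSL_apply_apply, innerSL_apply_apply, ← inner_conj_symm, h, inner_conj_symm]
  exact ext_inner_right ℂ fun v => by
    simpa only [innerSL_apply_apply] using congrArg (fun A => A v) this

/-- The permutation of `Fin (n + 1)` that fixes `0` and acts as `σ` on the successors. -/
def consPerm {n : ℕ} (σ : Equiv.Perm (Fin n)) : Equiv.Perm (Fin (n + 1)) :=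
  Equiv.Perm.decomposeFin.symm (0, σ)

theorem cons_comp_consPerm {α : Type*} {n : ℕ} (h : α) (f : Fin n → α) (σ : Equiv.Perm (Fin n)) :
    (Fin.cons h f : Fin (n + 1) → α) ∘ consPerm σ = Fin.cons h (f ∘ σ) := by
  funext i
  refine Fin.cases ?_ (fun j => ?_) i <;> simp [consPerm]

/-- Permutations of the last n factors are absorbed by the projection onto symmetric tensors, so the
n! terms of the inner average all have the same image. -/
theorem create_symTensor (h : H) {n : ℕ} (f : Fin n → H) :
    create h n (symTensor f) = ((Real.sqrt (n + 1) : ℝ) : ℂ) •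
      symTensor (Fin.cons h f : Fin (n + 1) → H) := by
  have e : create h n (symTensor f) = ((Real.sqrt (n + 1) : ℝ) : ℂ) •
      (symmetricPower H (n + 1)).orthogonalProjectionOnto
        (tensorLeft h n (symTensor f : TensorPower H n)) := rfl
  have e2 : ∀ σ : Equiv.Perm (Fin n), (symmetricPower H (n + 1)).orthogonalProjectionOnto
      (tprod (Fin.cons h (f ∘ σ) : Fin (n + 1) → H)) =
      symTensor (Fin.cons h f : Fin (n + 1) → H) := fun σ => by
    rw [← cons_comp_consPerm]; exact symTensor_comp _ _
  rw [e, coe_symTensor, map_smul, map_sum, map_smul, map_sum]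
  simp only [tensorLeft_tprod, e2]
  rw [Finset.sum_const, Finset.card_univ, Fintype.card_perm, Fintype.card_fin,
    ← Nat.cast_smul_eq_nsmul ℂ, smul_smul (_⁻¹),
    inv_mul_cancel₀ (by exact_mod_cast n.factorial_ne_zero), one_smul]

/-- In the inner product of two symmetrized tensors, each permutation contributes a product in which
the created factor occurs exactly once, at position `σ.symm 0`; additivity is read off there. -/
theorem create_add (h g : H) (n : ℕ) : create (h + g) n = create h n + create g n := by
  refine ext_symTensor fun f => ext_inner_right ℂ fun ψ => ?_
  rw [add_apply, create_symTensor, create_symTensor, create_symTensor, ← smul_add,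
    inner_smul_left, inner_smul_left]
  congr 1
  refine congrArg (fun χ => inner ℂ χ ψ) (ext_inner_symTensor fun k => ?_)
  simp only [inner_add_right, inner_symTensor, ← mul_add, ← Finset.sum_add_distrib]
  congr 1
  refine Finset.sum_congr rfl fun σ _ => ?_
  have e : ∀ v : H, ∏ i, inner ℂ (k i) ((Fin.cons v f : Fin (n + 1) → H) (σ i)) =
      inner ℂ (k (σ.symm 0)) v * ∏ j, inner ℂ (k (σ.symm j.succ)) (f j) := fun v => by
    rw [← Fintype.prod_equiv σ.symm (fun i => inner ℂ (k (σ.symm i))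
      ((Fin.cons v f : Fin (n + 1) → H) i)) _ fun i => by simp, Fin.prod_univ_succ]
    simp
  rw [e, e, e, inner_add_right, add_mul]

theorem annihilate_add (h g : H) (n : ℕ) :
    annihilate (h + g) n = annihilate h n + annihilate g n := by
  simp only [annihilate, create_add, map_add]

/-- The family of the factors of `f` other than the `p`-th, with the `0`-th in its place. -/
def removeFactor {α : Type*} {n : ℕ} (f : Fin (n + 1) → α) (p : Fin (n + 1)) : Fin n → α :=
  fun j => f (Equiv.swap 0 p j.succ)

/-- Expansion of a permanent along its first row: `Equiv.Perm.decomposeFin` splits a permutation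
into the image p of 0, which pairs h with `f p`, and a permutation of the remaining factors. -/
theorem annihilate_symTensor (h : H) {n : ℕ} (f : Fin (n + 1) → H) :
    annihilate h n (symTensor f) = ((Real.sqrt (n + 1) : ℝ) : ℂ)⁻¹ •
      ∑ p, inner ℂ h (f p) • symTensor (removeFactor f p) := by
  refine ext_inner_symTensor fun g => ?_
  have hs : ((Real.sqrt (n + 1) : ℝ) : ℂ) ≠ 0 := by
    exact_mod_cast (Real.sqrt_pos.2 (by positivity : (0 : ℝ) < n + 1)).ne'
  have hs2 : ((Real.sqrt (n + 1) : ℝ) : ℂ) * ((Real.sqrt (n + 1) : ℝ) : ℂ) = n + 1 := by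
    rw [← Complex.ofReal_mul, Real.mul_self_sqrt (by positivity)]; push_cast; rfl
  have hf : (n.factorial : ℂ) ≠ 0 := by exact_mod_cast n.factorial_ne_zero
  have hn : (n + 1 : ℂ) ≠ 0 := by exact_mod_cast n.succ_ne_zero
  rw [annihilate, ContinuousLinearMap.adjoint_inner_right, create_symTensor, inner_smul_left,
    Complex.conj_ofReal, inner_symTensor, inner_smul_right, inner_sum,
    ← Equiv.Perm.decomposeFin.symm.sum_comp, Fintype.sum_prod_type]
  simp only [inner_smul_right, inner_symTensor, Fin.prod_univ_succ, Fin.cons_zero, Fin.cons_succ,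
    Equiv.Perm.decomposeFin_symm_apply_zero, Equiv.Perm.decomposeFin_symm_apply_succ,
    removeFactor, ← Finset.mul_sum, mul_left_comm _ ((n.factorial : ℂ)⁻¹)]
  -- The constants agree because √(n+1) / (n+1)! = 1 / (√(n+1) n!).
  rw [← mul_assoc, ← mul_assoc, Nat.factorial_succ]
  congr 1
  push_cast
  rw [mul_inv, ← hs2]
  field_simp

/-- The two sides differ by the transposition of the first two factors, which symmetrization does
not see. -/
theorem create_create_comm (h g : H) (n : ℕ) (ψ : symmetricPower H n) :
    create h (n + 1) (create g n ψ) = create g (n + 1) (create h n ψ) := by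
  suffices e : create h (n + 1) ∘L create g n = create g (n + 1) ∘L create h n from
    congrArg (fun A => A ψ) e
  refine ext_symTensor fun f => ?_
  simp only [ContinuousLinearMap.comp_apply, create_symTensor, map_smul]
  congr 2
  rw [← symTensor_comp _ (Equiv.swap 0 1)]
  congr 1
  funext i
  refine Fin.cases ?_ (fun j => Fin.cases ?_ (fun k => ?_) j) i
  · rw [Function.comp_apply, Equiv.swap_apply_left]; rfl
  · rw [Function.comp_apply, Fin.succ_zero_eq_one, Equiv.swap_apply_right]; rfl
  · rw [Function.comp_apply, Equiv.swap_apply_of_ne_of_ne (Fin.succ_ne_zero _)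
      (by simp [Fin.ext_iff])]
    simp

theorem annihilate_annihilate_comm (h g : H) (n : ℕ) (ψ : symmetricPower H (n + 2)) :
    annihilate h n (annihilate g (n + 1) ψ) = annihilate g n (annihilate h (n + 1) ψ) := by
  refine ext_inner_left ℂ fun v => ?_
  simp only [annihilate, ContinuousLinearMap.adjoint_inner_right]
  rw [create_create_comm]

theorem removeFactor_cons_zero {α : Type*} (g : α) {n : ℕ} (f : Fin n → α) :
    removeFactor (Fin.cons g f : Fin (n + 1) → α) 0 = f := by
  funext j
  simp [removeFactor]

theorem removeFactor_cons_succ {α : Type*} (g : α) {n : ℕ} (f : Fin n → α) (q : Fin n) :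
    removeFactor (Fin.cons g f : Fin (n + 1) → α) q.succ = Function.update f q g := by
  funext j
  by_cases hj : j = q
  · subst hj; simp [removeFactor]
  · rw [removeFactor, Equiv.swap_apply_of_ne_of_ne (Fin.succ_ne_zero _)
      (fun h => hj (Fin.succ_injective _ h)), Fin.cons_succ, Function.update_of_ne hj]

/-- The two families differ by the transposition of 0 and q. This matches "annihilate, then create"
with "create, then annihilate an older factor". -/
theorem symTensor_cons_removeFactor (g : H) {n : ℕ} (f : Fin (n + 1) → H) (q : Fin (n + 1)) :
    symTensor (Fin.cons g (removeFactor f q) : Fin (n + 1) → H) =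
      symTensor (Function.update f q g) := by
  rw [← symTensor_comp (Function.update f q g) (Equiv.swap 0 q)]
  congr 1
  funext i
  refine Fin.cases (by simp) (fun j => ?_) i
  have : Equiv.swap 0 q j.succ ≠ q := fun h => by
    have := (Equiv.swap_apply_eq_iff.1 h)
    rw [Equiv.swap_apply_right] at this
    exact Fin.succ_ne_zero _ this
  simp [removeFactor, Function.update_of_ne this]

theorem annihilate_create_zero (h g : H) (ψ : symmetricPower H 0) :
    annihilate h 0 (create g 0 ψ) = inner ℂ h g • ψ := by
  suffices e : annihilate h 0 ∘L create g 0 =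
      inner ℂ h g • ContinuousLinearMap.id ℂ (symmetricPower H 0) from congrArg (fun A => A ψ) e
  refine ext_symTensor fun f => ?_
  simp [create_symTensor, annihilate_symTensor, removeFactor_cons_zero]

theorem annihilate_create_succ (h g : H) (n : ℕ) (ψ : symmetricPower H (n + 1)) :
    annihilate h (n + 1) (create g (n + 1) ψ) =
      create g n (annihilate h n ψ) + inner ℂ h g • ψ := by
  suffices e : annihilate h (n + 1) ∘L create g (n + 1) = create g n ∘L annihilate h n +
      inner ℂ h g • ContinuousLinearMap.id ℂ (symmetricPower H (n + 1)) from
    congrArg (fun A => A ψ) e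
  refine ext_symTensor fun f => ?_
  have hs : ∀ m : ℕ, ((Real.sqrt (m + 1) : ℝ) : ℂ) ≠ 0 := fun m => by
    exact_mod_cast (Real.sqrt_pos.2 (by positivity : (0 : ℝ) < m + 1)).ne'
  simp only [ContinuousLinearMap.comp_apply, add_apply, smul_apply, ContinuousLinearMap.id_apply,
    create_symTensor, annihilate_symTensor, map_smul, map_sum, smul_smul, Finset.smul_sum]
  -- Annihilating the factor g just created gives the scalar term; annihilating one of the old
  -- factors gives the term with the order reversed.
  refine (Fin.sum_univ_succ _).trans ((add_comm _ _).trans ?_)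
  simp only [Fin.cons_zero, Fin.cons_succ, removeFactor_cons_zero, removeFactor_cons_succ,
    symTensor_cons_removeFactor]
  congr 1
  · refine Finset.sum_congr rfl fun q _ => ?_
    congr 1
    have := hs n
    have := hs (n + 1)
    field_simp
  · congr 1
    have := hs (n + 1)
    field_simp

end SymmetricTensors

/-! ### Canonical commutation relations on the finite particle domain -/

section CommutationRelations
variable {H : Type*} [NormedAddCommGroup H] [InnerProductSpace ℂ H]

theorem createOp_comm (h g : H) : createOp h * createOp g = createOp g * createOp h := by
  refine LinearMap.ext fun ψ => Subtype.ext (lp.ext (funext fun n => ?_))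
  match n with
  | 0 => rfl
  | 1 =>
    refine (map_zero (create h 0)).trans (map_zero (create g 0)).symm
  | n + 2 => exact create_create_comm h g n (ψ.1 n)

theorem annihilateOp_comm (h g : H) :
    annihilateOp h * annihilateOp g = annihilateOp g * annihilateOp h :=
  LinearMap.ext fun ψ => Subtype.ext (lp.ext (funext fun n =>
    annihilate_annihilate_comm h g n (ψ.1 (n + 2))))

theorem annihilateOp_mul_createOp (h g : H) :
    annihilateOp h * createOp g = createOp g * annihilateOp h + inner ℂ h g • 1 := by
  refine LinearMap.ext fun ψ => Subtype.ext (lp.ext (funext fun n => ?_))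
  match n with
  | 0 => exact (annihilate_create_zero h g (ψ.1 0)).trans (zero_add _).symm
  | n + 1 => exact annihilate_create_succ h g n (ψ.1 (n + 1))

theorem createOp_add (h g : H) : createOp (h + g) = createOp h + createOp g := by
  refine LinearMap.ext fun ψ => Subtype.ext (lp.ext (funext fun n => ?_))
  match n with
  | 0 => exact (add_zero _).symm
  | n + 1 => exact congrArg (fun A => A (ψ.1 n)) (create_add h g n)

theorem annihilateOp_add (h g : H) :
    annihilateOp (h + g) = annihilateOp h + annihilateOp g :=
  LinearMap.ext fun ψ => Subtype.ext (lp.ext (funext fun n =>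
    congrArg (fun A => A (ψ.1 (n + 1))) (annihilate_add h g n)))

theorem fieldOp_add (h g : H) : fieldOp (h + g) = fieldOp h + fieldOp g := by
  rw [fieldOp, fieldOp, fieldOp, createOp_add, annihilateOp_add, ← smul_add]
  congr 1
  abel

theorem fieldOp_zero : fieldOp (0 : H) = 0 := by
  have := fieldOp_add (0 : H) 0
  rwa [add_zero, left_eq_add] at this

theorem fieldOp_neg (h : H) : fieldOp (-h) = -fieldOp h := by
  refine eq_neg_of_add_eq_zero_left ?_
  rw [← fieldOp_add, neg_add_cancel, fieldOp_zero]

/-- The canonical commutation relation `[A(h), A(g)] = i Im ⟨h, g⟩`. -/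
theorem fieldOp_mul_fieldOp (h g : H) :
    fieldOp h * fieldOp g = fieldOp g * fieldOp h +
      (Complex.I * ((inner ℂ h g : ℂ).im : ℂ)) • 1 := by
  have hs : ((1 / Real.sqrt 2 : ℝ) : ℂ) * ((1 / Real.sqrt 2 : ℝ) : ℂ) = 1 / 2 := by
    rw [← Complex.ofReal_mul, div_mul_div_comm, Real.mul_self_sqrt (by norm_num)]
    norm_num
  have hi : Complex.I * ((inner ℂ h g : ℂ).im : ℂ) =
      1 / 2 * (inner ℂ h g - inner ℂ g h) := by
    rw [← inner_conj_symm g h, Complex.sub_conj]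
    push_cast
    ring
  have e1 := annihilateOp_mul_createOp h g
  have e2 := annihilateOp_mul_createOp g h
  rw [hi]
  simp only [fieldOp, smul_mul_smul_comm, hs, mul_smul, ← smul_add]
  congr 1
  simp only [mul_add, add_mul, e1, e2, createOp_comm h g, annihilateOp_comm h g, sub_smul]
  abel

end CommutationRelations

/-! ### The Baker–Campbell–Hausdorff identity for a central commutator, without convergence -/

section BakerCampbellHausdorff
variable {R : Type*} [Ring R] [Algebra ℂ R]

/-- The divided power `X ^ n / n!`. -/
def divPow (X : R) (n : ℕ) : R := ((n.factorial : ℂ)⁻¹) • X ^ n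

theorem divPow_zero (X : R) : divPow X 0 = 1 := by simp [divPow]

theorem mul_divPow (X : R) (n : ℕ) :
    X * divPow X n = (n + 1 : ℂ) • divPow X (n + 1) := by
  have : (n + 1 : ℂ) ≠ 0 := by exact_mod_cast n.succ_ne_zero
  rw [divPow, divPow, mul_smul_comm, ← pow_succ', smul_smul, Nat.factorial_succ]
  congr 1
  push_cast
  rw [mul_inv, mul_inv_cancel_left₀ this]

theorem pow_succ_mul_of_commutator {X Y : R} {c : ℂ} (h : X * Y = Y * X + c • 1) (n : ℕ) :
    X ^ (n + 1) * Y = Y * X ^ (n + 1) + ((n + 1 : ℂ) * c) • X ^ n := by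
  induction n with
  | zero => simpa using h
  | succ n ih =>
    rw [pow_succ' X (n + 1), mul_assoc, ih, mul_add, ← mul_assoc, h, add_mul, mul_smul_comm,
      ← pow_succ', mul_assoc, smul_mul_assoc, one_mul, add_assoc, ← add_smul]
    congr 2
    push_cast
    ring

/-- The coefficient of t^(n+1) in e^{tX} Y = (Y + ct) e^{tX}. -/
theorem divPow_succ_mul_of_commutator {X Y : R} {c : ℂ} (h : X * Y = Y * X + c • 1) (n : ℕ) :
    divPow X (n + 1) * Y = Y * divPow X (n + 1) + c • divPow X n := by
  have : (n + 1 : ℂ) ≠ 0 := by exact_mod_cast n.succ_ne_zero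
  rw [divPow, divPow, smul_mul_assoc, pow_succ_mul_of_commutator h, smul_add, mul_smul_comm,
    smul_smul, smul_smul, Nat.factorial_succ]
  congr 2
  push_cast
  rw [mul_inv]
  field_simp

/-- The coefficients of the power series of `exp (c t ^ 2 / 2)`. -/
def gaussCoeff (c : ℂ) : ℕ → ℂ
  | 0 => 1
  | 1 => 0
  | n + 2 => c / (n + 2) * gaussCoeff c n

theorem gaussCoeff_succ_succ (c : ℂ) (n : ℕ) :
    (n + 2 : ℂ) * gaussCoeff c (n + 2) = c * gaussCoeff c n := by
  have : (n + 2 : ℂ) ≠ 0 := by exact_mod_cast (n + 1).succ_ne_zero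
  rw [gaussCoeff]
  field_simp

theorem gaussCoeff_even (c : ℂ) (n : ℕ) :
    gaussCoeff c (2 * n) = (c / 2) ^ n / n.factorial := by
  induction n with
  | zero => simp [gaussCoeff]
  | succ n ih =>
    have : (n + 1 : ℂ) ≠ 0 := by exact_mod_cast n.succ_ne_zero
    have f : (n.factorial : ℂ) ≠ 0 := by exact_mod_cast n.factorial_ne_zero
    rw [mul_add, mul_one, gaussCoeff, ih, Nat.factorial_succ, pow_succ]
    push_cast
    rw [show (2 * n + 2 : ℂ) = 2 * (n + 1) by ring]
    field_simp

theorem gaussCoeff_odd (c : ℂ) (n : ℕ) : gaussCoeff c (2 * n + 1) = 0 := by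
  induction n with
  | zero => rfl
  | succ n ih => rw [mul_add, mul_one, add_right_comm, gaussCoeff, ih, mul_zero]

theorem summable_norm_gaussCoeff (c : ℂ) : Summable fun n => ‖gaussCoeff c n‖ := by
  refine Summable.even_add_odd ?_ ?_
  · simp only [gaussCoeff_even, norm_div, norm_pow, Complex.norm_natCast]
    exact Real.summable_pow_div_factorial _
  · simpa only [gaussCoeff_odd, norm_zero] using summable_zero

theorem hasSum_gaussCoeff (c : ℂ) : HasSum (gaussCoeff c) (Complex.exp (c / 2)) := by
  have h1 : HasSum (fun n => gaussCoeff c (2 * n)) (Complex.exp (c / 2)) := by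
    simp only [gaussCoeff_even, Complex.exp_eq_exp_ℂ]
    exact NormedSpace.expSeries_div_hasSum_exp _
  have h2 : HasSum (fun n => gaussCoeff c (2 * n + 1)) 0 := by
    simpa only [gaussCoeff_odd] using hasSum_zero
  simpa using h1.even_add_odd h2

/-- Uniqueness of the power series solution of F' = (Z + ct) F. For Z = X + Y and [X, Y] = c, both
e^{tX} e^{tY} and e^{t(X+Y)} e^{ct²/2} solve this equation. -/
theorem eq_of_three_term_recurrence {P Q : ℕ → R} {Z : R} {c : ℂ} (h0 : P 0 = Q 0)
    (h1 : P 1 = Q 1)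
    (hP : ∀ d : ℕ, (d + 2 : ℂ) • P (d + 2) = Z * P (d + 1) + c • P d)
    (hQ : ∀ d : ℕ, (d + 2 : ℂ) • Q (d + 2) = Z * Q (d + 1) + c • Q d) (d : ℕ) : P d = Q d := by
  induction d using Nat.twoStepInduction with
  | zero => exact h0
  | one => exact h1
  | more d ih1 ih2 =>
    have : (d + 2 : ℂ) ≠ 0 := by exact_mod_cast (d + 1).succ_ne_zero
    have e := hP d
    rw [ih1, ih2, ← hQ d] at e
    exact smul_right_injective _ this e

open Finset.Nat in
/-- The homogeneous components of `exp X * exp Y = exp (X + Y) * exp (c / 2)` for `[X, Y] = c`. -/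
theorem sum_divPow_mul_divPow {X Y : R} {c : ℂ} (h : X * Y = Y * X + c • 1) (d : ℕ) :
    ∑ x ∈ Finset.HasAntidiagonal.antidiagonal d, divPow X x.1 * divPow Y x.2 =
      ∑ x ∈ Finset.HasAntidiagonal.antidiagonal d, gaussCoeff c x.1 • divPow (X + Y) x.2 := by
  have one : ∀ Z : R, divPow Z 1 = Z := fun Z => by simp [divPow]
  refine eq_of_three_term_recurrence (Z := X + Y) (c := c)
    (P := fun d => ∑ x ∈ Finset.HasAntidiagonal.antidiagonal d, divPow X x.1 * divPow Y x.2)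
    (Q := fun d => ∑ x ∈ Finset.HasAntidiagonal.antidiagonal d, gaussCoeff c x.1 • divPow (X + Y) x.2)
    ?_ ?_ (fun d => ?_) (fun d => ?_) d
  · simp [divPow_zero, gaussCoeff]
  · simp [sum_antidiagonal_succ, divPow_zero, gaussCoeff, one, add_comm]
  -- Leibniz rule: the degree d + 2 is the sum of the two exponents, so the factor d + 2
  -- differentiates each factor in turn.
  · have key : ∀ x ∈ Finset.HasAntidiagonal.antidiagonal (d + 2),
        (d + 2 : ℂ) • (divPow X x.1 * divPow Y x.2) =
          ((x.1 : ℂ) • divPow X x.1) * divPow Y x.2 +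
            divPow X x.1 * ((x.2 : ℂ) • divPow Y x.2) := fun x hx => by
      rw [smul_mul_assoc, mul_smul_comm, ← add_smul]
      congr 1
      exact_mod_cast (Finset.HasAntidiagonal.mem_antidiagonal.1 hx).symm
    rw [Finset.smul_sum, Finset.sum_congr rfl key, Finset.sum_add_distrib,
      sum_antidiagonal_succ, sum_antidiagonal_succ'
        (f := fun x => divPow X x.1 * ((x.2 : ℂ) • divPow Y x.2))]
    simp only [Nat.cast_zero, zero_smul, zero_mul, mul_zero, zero_add, Nat.cast_add,
      Nat.cast_one, ← mul_divPow]
    -- Moving Y to the left past the powers of X costs c times the component of degree one less.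
    have key2 : ∑ x ∈ Finset.HasAntidiagonal.antidiagonal (d + 1), divPow X x.1 * (Y * divPow Y x.2) =
        Y * ∑ x ∈ Finset.HasAntidiagonal.antidiagonal (d + 1), divPow X x.1 * divPow Y x.2 +
          c • ∑ x ∈ Finset.HasAntidiagonal.antidiagonal d, divPow X x.1 * divPow Y x.2 := by
      rw [sum_antidiagonal_succ, sum_antidiagonal_succ]
      simp only [← mul_assoc, divPow_succ_mul_of_commutator h, add_mul, Finset.sum_add_distrib,
        divPow_zero, one_mul, mul_add, Finset.mul_sum, smul_mul_assoc, Finset.smul_sum,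
        add_assoc]
    rw [key2, add_mul, ← add_assoc]
    simp only [mul_assoc, Finset.mul_sum]
  · have key : ∀ x ∈ Finset.HasAntidiagonal.antidiagonal (d + 2),
        (d + 2 : ℂ) • (gaussCoeff c x.1 • divPow (X + Y) x.2) =
          ((x.1 : ℂ) * gaussCoeff c x.1) • divPow (X + Y) x.2 +
            gaussCoeff c x.1 • ((x.2 : ℂ) • divPow (X + Y) x.2) := fun x hx => by
      rw [smul_smul, smul_smul, ← add_smul, mul_comm (gaussCoeff c x.1), ← add_mul]
      congr 2
      exact_mod_cast (Finset.HasAntidiagonal.mem_antidiagonal.1 hx).symm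
    rw [Finset.smul_sum, Finset.sum_congr rfl key, Finset.sum_add_distrib,
      sum_antidiagonal_succ, sum_antidiagonal_succ, sum_antidiagonal_succ']
    have e : ∀ n : ℕ, (((n + 1 + 1 : ℕ) : ℂ)) * gaussCoeff c (n + 1 + 1) = c * gaussCoeff c n :=
      fun n => by rw [← gaussCoeff_succ_succ]; push_cast; ring
    simp only [e]
    simp only [Nat.cast_zero, zero_smul, zero_mul, mul_zero, smul_zero, zero_add,
      Nat.cast_add, Nat.cast_one, ← mul_divPow, gaussCoeff, ← mul_smul_comm, ← Finset.mul_sum,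
      mul_smul, ← Finset.smul_sum]
    rw [add_comm]

end BakerCampbellHausdorff

/-! ### The Weyl relation for exponential series of symmetric operators -/

section Exponential
variable {F : Type*} [NormedAddCommGroup F] [InnerProductSpace ℂ F] {D : Submodule ℂ F}

theorem expTerm_eq_divPow (A : D →ₗ[ℂ] D) (ψ : D) (k : ℕ) :
    expTerm A ψ k = (divPow (R := Module.End ℂ D) (Complex.I • A) k ψ : D) := by
  have e : (Complex.I • A) ^ k = Complex.I ^ k • A ^ k := smul_pow Complex.I A k
  rw [divPow, e, smul_smul, expTerm, div_eq_inv_mul]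
  rfl

/-- Formal adjoint of e^{iA}, term by term. With it both exponential series act on vectors of D,
where they converge. -/
theorem inner_expTerm_neg {A : D →ₗ[ℂ] D}
    (hA : ∀ ψ φ : D, inner ℂ ((A ψ : D) : F) (φ : F) = inner ℂ (ψ : F) ((A φ : D) : F))
    (ψ φ : D) (j : ℕ) :
    inner ℂ (expTerm (-A) ψ j) (φ : F) =
      inner ℂ (ψ : F) (expTerm A φ j) := by
  have e : (-A) ^ j = (-1 : ℂ) ^ j • A ^ j := by rw [← smul_pow, neg_one_smul]
  have e2 := inner_pow_pow hA ψ j 0 φ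
  rw [pow_zero, add_zero, Module.End.one_apply] at e2
  rw [expTerm, expTerm, e, LinearMap.smul_apply, Submodule.coe_smul,
    inner_smul_left, inner_smul_left, inner_smul_right, e2, ← mul_assoc]
  congr 1
  simp only [map_div₀, map_pow, Complex.conj_I, map_natCast, map_neg, map_one]
  rw [div_mul_eq_mul_div, ← mul_pow]
  simp

/-- The Weyl relation for the exponential series of symmetric operators with `[A, B] = i θ`. -/
theorem inner_tsum_expTerm [CompleteSpace F] {A B : D →ₗ[ℂ] D} {θ : ℝ}
    (hA : ∀ ψ φ : D, inner ℂ ((A ψ : D) : F) (φ : F) = inner ℂ (ψ : F) ((A φ : D) : F))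
    (hAB : A * B = B * A + (Complex.I * θ) • (1 : Module.End ℂ D)) (φ ψ : D)
    (ha : Summable fun k => ‖expTerm (-A) φ k‖) (hb : Summable fun k => ‖expTerm B ψ k‖)
    (hab : Summable fun k => ‖expTerm (A + B) ψ k‖) :
    inner ℂ (∑' k, expTerm (-A) φ k) (∑' k, expTerm B ψ k) =
      Complex.exp (-(Complex.I * θ) / 2) * inner ℂ (φ : F) (∑' k, expTerm (A + B) ψ k) := by
  -- The factor i² turns [A, B] = iθ into [iA, iB] = -iθ, whence the phase e^{-iθ/2}.
  have hcomm : (Complex.I • A : Module.End ℂ D) * (Complex.I • B) =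
      (Complex.I • B) * (Complex.I • A) + (-(Complex.I * θ)) • 1 := by
    rw [smul_mul_smul_comm, smul_mul_smul_comm, hAB, smul_add, smul_smul, Complex.I_mul_I,
      neg_one_mul]
  set a := expTerm (-A) φ
  set b := expTerm B ψ
  have hsa : HasSum a (∑' k, a k) := ha.of_norm.hasSum
  have hsb : HasSum b (∑' k, b k) := hb.of_norm.hasSum
  -- Absolute convergence allows the double series to be regrouped by total degree, where the
  -- algebraic identity applies.
  have hprod : Summable fun x : ℕ × ℕ => inner ℂ (a x.1) (b x.2) := by
    refine Summable.of_norm_bounded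
      (ha.mul_of_nonneg hb (fun _ => norm_nonneg _) (fun _ => norm_nonneg _)) fun x => ?_
    exact norm_inner_le_norm _ _
  have h1 : inner ℂ (∑' k, a k) (∑' k, b k) = ∑' x : ℕ × ℕ, inner ℂ (a x.1) (b x.2) := by
    rw [hprod.tsum_prod]
    have e2 : ∀ j, ∑' k, inner ℂ (a j) (b k) = inner ℂ (a j) (∑' k, b k) := fun j =>
      ((innerSL ℂ (a j)).hasSum hsb).tsum_eq
    simp only [e2]
    have := (ContinuousLinearMap.hasSum (innerSL ℂ (∑' k, b k)) hsa).star
    simp only [innerSL_apply_apply] at this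
    have h3 := this.tsum_eq
    simp only [← starRingEnd_apply, inner_conj_symm] at h3
    exact h3.symm
  have h2 : ∀ n, ∑ x ∈ Finset.HasAntidiagonal.antidiagonal n, inner ℂ (a x.1) (b x.2) =
      ∑ x ∈ Finset.HasAntidiagonal.antidiagonal n,
        gaussCoeff (-(Complex.I * θ)) x.1 * inner ℂ (φ : F) (expTerm (A + B) ψ x.2) := by
    intro n
    have e := congrArg (fun T : Module.End ℂ D => inner ℂ (φ : F) (T ψ : F))
      (sum_divPow_mul_divPow hcomm n)
    simp only [LinearMap.sum_apply, AddSubmonoidClass.coe_finsetSum, inner_sum,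
      Module.End.mul_apply, LinearMap.smul_apply, Submodule.coe_smul, inner_smul_right,
      ← smul_add, ← expTerm_eq_divPow] at e
    rw [← e]
    refine Finset.sum_congr rfl fun x _ => ?_
    simp only [a, b, expTerm_eq_divPow B]
    rw [inner_expTerm_neg hA]
  have hc : Summable fun k => ‖inner ℂ (φ : F) (expTerm (A + B) ψ k)‖ :=
    (hab.mul_left ‖(φ : F)‖).of_nonneg_of_le (fun _ => norm_nonneg _)
      fun k => norm_inner_le_norm _ _
  have h3 : ∑' k, inner ℂ (φ : F) (expTerm (A + B) ψ k) =
      inner ℂ (φ : F) (∑' k, expTerm (A + B) ψ k) :=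
    ((innerSL ℂ (φ : F)).hasSum hab.of_norm.hasSum).tsum_eq
  rw [h1, ← h3, ← (hasSum_gaussCoeff (-(Complex.I * θ))).tsum_eq,
    tsum_mul_tsum_eq_tsum_sum_antidiagonal_of_summable_norm (summable_norm_gaussCoeff _) hc,
    ← Finset.HasAntidiagonal.sigmaAntidiagonalEquivProd.tsum_eq]
  have hs' := (Finset.HasAntidiagonal.sigmaAntidiagonalEquivProd.summable_iff
    (f := fun x : ℕ × ℕ => inner ℂ (a x.1) (b x.2))).2 hprod
  refine (Summable.tsum_sigma' (fun n => (hasSum_fintype _).summable) hs').trans ?_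
  refine tsum_congr fun n => ?_
  rw [tsum_fintype, ← h2 n]
  exact Finset.sum_coe_sort (Finset.HasAntidiagonal.antidiagonal n)
    (fun x => inner ℂ (a x.1) (b x.2))

end Exponential

/-! ### Weyl operators: unitarity, Weyl relation, strong continuity -/

section WeylOperators
variable {H : Type*} [NormedAddCommGroup H] [InnerProductSpace ℂ H]

/-- A finite particle vector as a vector in Fock space. -/
def toFock (ψ : finiteParticle H) : FockSpace H := ψ.1

theorem denseRange_toFock : DenseRange (toFock (H := H)) :=
  (dense_finiteParticle (H := H)).denseRange_val

/-- Weak form of the Weyl relation, written before W(-h) is known to be the adjoint of W(h). Both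
sides are continuous in φ and ψ, so finite particle vectors suffice; g = 0 and g = -h then give the
adjoint and the isometry. -/
theorem inner_weyl_neg_weyl (h g : H) (φ ψ : FockSpace H) :
    inner ℂ (weyl (-h) φ) (weyl g ψ) =
      Complex.exp (-(Complex.I * ((inner ℂ h g : ℂ).im : ℂ)) / 2) *
        inner ℂ φ (weyl (h + g) ψ) := by
  refine isClosed_property2 (p := fun φ ψ : FockSpace H => inner ℂ (weyl (-h) φ) (weyl g ψ) =
      Complex.exp (-(Complex.I * ((inner ℂ h g : ℂ).im : ℂ)) / 2) *
        inner ℂ φ (weyl (h + g) ψ)) denseRange_toFock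
    (isClosed_eq (by fun_prop) (by fun_prop)) (fun φ ψ => ?_) φ ψ
  have s1 := summable_expTerm_fieldOp (-h) φ
  have s2 := summable_expTerm_fieldOp (h + g) ψ
  have e1 := (hasSum_weyl (-h) φ).tsum_eq
  have e2 := (hasSum_weyl g ψ).tsum_eq
  have e3 := (hasSum_weyl (h + g) ψ).tsum_eq
  rw [fieldOp_neg] at s1 e1
  rw [fieldOp_add] at s2 e3
  have := inner_tsum_expTerm (inner_fieldOp h) (fieldOp_mul_fieldOp h g) φ ψ s1
    (summable_expTerm_fieldOp g ψ) s2
  rw [e1, e2, e3] at this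
  exact this

theorem weyl_zero : weyl (0 : H) = 1 := by
  refine ContinuousLinearMap.ext fun ψ => ?_
  refine isClosed_property (p := fun ψ : FockSpace H => weyl 0 ψ = ψ) denseRange_toFock
    (isClosed_eq (by fun_prop) (by fun_prop)) (fun ψ => ?_) ψ
  refine (hasSum_weyl 0 ψ).unique ?_
  have : HasSum (expTerm (fieldOp (0 : H)) ψ) (expTerm (fieldOp (0 : H)) ψ 0) :=
    hasSum_single 0 fun k hk => by
      rw [expTerm, fieldOp_zero, zero_pow hk]
      exact smul_zero _
  simpa [expTerm, toFock] using this

theorem inner_weyl_weyl_self (h : H) (φ ψ : FockSpace H) :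
    inner ℂ (weyl h φ) (weyl h ψ) = inner ℂ φ ψ := by
  have := inner_weyl_neg_weyl (-h) h φ ψ
  rw [neg_neg, neg_add_cancel, weyl_zero, inner_neg_left, Complex.neg_im,
    show (inner ℂ h h : ℂ).im = 0 from inner_self_im (𝕜 := ℂ) h] at this
  simpa using this

theorem norm_weyl (h : H) (ψ : FockSpace H) : ‖weyl h ψ‖ = ‖ψ‖ := by
  rw [norm_eq_sqrt_re_inner (𝕜 := ℂ), inner_weyl_weyl_self, ← norm_eq_sqrt_re_inner]

theorem inner_weyl_neg_left (h : H) (φ ψ : FockSpace H) :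
    inner ℂ (weyl (-h) φ) ψ = inner ℂ φ (weyl h ψ) := by
  have := inner_weyl_neg_weyl h 0 φ ψ
  rw [weyl_zero, add_zero, inner_zero_right] at this
  simpa using this

theorem star_weyl (h : H) : star (weyl h) = weyl (-h) := by
  refine ContinuousLinearMap.ext fun ψ => ext_inner_right ℂ fun φ => ?_
  rw [ContinuousLinearMap.star_eq_adjoint, ContinuousLinearMap.adjoint_inner_left,
    inner_weyl_neg_left]

/-- The Weyl relation. -/
theorem weyl_mul_weyl (h g : H) : weyl h * weyl g =
    Complex.exp (-(Complex.I * ((inner ℂ h g : ℂ).im : ℂ)) / 2) • weyl (h + g) := by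
  refine ContinuousLinearMap.ext fun ψ => ext_inner_left ℂ fun φ => ?_
  rw [smul_apply, inner_smul_right, ← inner_weyl_neg_weyl, inner_weyl_neg_left]
  rfl

/-- Conjugation by W(f) multiplies W(h) by a phase: the two applications of the Weyl relation
contribute half of the angle each. -/
theorem inner_weyl_weyl_weyl (f h : H) (φ : FockSpace H) :
    inner ℂ (weyl f φ) (weyl h (weyl f φ)) =
      Complex.exp (Complex.I * ((inner ℂ f h : ℂ).im : ℂ)) * inner ℂ φ (weyl h φ) := by
  have e1 : weyl h (weyl f φ) =
      Complex.exp (-(Complex.I * ((inner ℂ h f : ℂ).im : ℂ)) / 2) • weyl (h + f) φ :=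
    congrArg (fun T => T φ) (weyl_mul_weyl h f)
  have e2 := inner_weyl_neg_weyl (-f) (h + f) φ φ
  rw [neg_neg, show -f + (h + f) = h by abel] at e2
  have e3 : (inner ℂ h f : ℂ).im = -(inner ℂ f h : ℂ).im := by
    rw [← inner_conj_symm, Complex.conj_im]
  have e4 : (inner ℂ f f : ℂ).im = 0 := inner_self_im (𝕜 := ℂ) f
  rw [e1, inner_smul_right, e2, ← mul_assoc, ← Complex.exp_add, e3, inner_neg_left,
    Complex.neg_im, inner_add_right, Complex.add_im, e4]
  congr 2
  push_cast
  ring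

theorem norm_vacuum : ‖vacuum H‖ = 1 := by
  have e : ‖vacuum H‖ = ‖(tprod Fin.elim0 : TensorPower H 0)‖ :=
    lp.norm_single (E := fun n => symmetricPower H n) (p := 2) (by norm_num) 0 _
  rw [e, norm_eq_sqrt_re_inner (𝕜 := ℂ), inner_tprod]
  simp

/-- The power of ‖h‖ is split off from a factor independent of h, to obtain estimates uniform in h.
-/
theorem partialNorm_fieldOp_pow (h : H) {N : ℕ} {ψ : finiteParticle H}
    (hψ : ∀ n, N ≤ n → ψ.1 n = 0) (k : ℕ) :
    (∀ n, N + k ≤ n → ((fieldOp h ^ k) ψ).1 n = 0) ∧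
      partialNorm (N + k) ((fieldOp h ^ k) ψ).1 ≤
        ‖h‖ ^ k * (∏ j ∈ Finset.range k, 2 * Real.sqrt ((N + j : ℕ) + 1)) *
          partialNorm N ψ.1 := by
  induction k with
  | zero => simpa using hψ
  | succ k ih =>
    rw [pow_succ' (fieldOp h), Module.End.mul_apply, ← add_assoc]
    refine ⟨fieldOp_support h ih.1, (partialNorm_fieldOp h ih.1).trans ?_⟩
    refine (mul_le_mul_of_nonneg_left ih.2 (by positivity)).trans (le_of_eq ?_)
    rw [Finset.prod_range_succ]
    ring

/-- Ratio test: consecutive terms have ratio 2√(N+k+1)/(k+1), which tends to 0. -/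
theorem summable_prod_sqrt_div_factorial (N : ℕ) : Summable fun k : ℕ =>
    (∏ j ∈ Finset.range k, 2 * Real.sqrt ((N + j : ℕ) + 1)) / k.factorial := by
  refine summable_of_ratio_test_tendsto_lt_one (l := 0) zero_lt_one
    (Filter.Eventually.of_forall fun k => ?_) ?_
  · exact (div_pos (Finset.prod_pos fun j _ => by positivity) (by positivity)).ne'
  have h1 : Filter.Tendsto (fun k : ℕ => 2 * Real.sqrt (N + 1) * (1 / Real.sqrt ((k : ℝ) + 1)))
      Filter.atTop (nhds 0) := by
    have : Filter.Tendsto (fun j : ℕ => Real.sqrt ((j : ℝ) + 1)) Filter.atTop Filter.atTop :=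
      Real.tendsto_sqrt_atTop.comp
        (Filter.tendsto_atTop_add_const_right _ _ tendsto_natCast_atTop_atTop)
    simpa using (this.inv_tendsto_atTop).const_mul (2 * Real.sqrt (N + 1))
  refine squeeze_zero (fun k => by positivity) (fun k => ?_) h1
  have hp : 0 < ∏ j ∈ Finset.range k, 2 * Real.sqrt ((N + j : ℕ) + 1) :=
    Finset.prod_pos fun j _ => by positivity
  have hf : (0 : ℝ) < k.factorial := by positivity
  have hk : (0 : ℝ) < (k : ℝ) + 1 := by positivity
  have hs : Real.sqrt ((N + k : ℕ) + 1) ≤ Real.sqrt (N + 1) * Real.sqrt ((k : ℝ) + 1) := by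
    rw [← Real.sqrt_mul (by positivity)]
    refine Real.sqrt_le_sqrt ?_
    push_cast
    nlinarith [mul_nonneg (Nat.cast_nonneg (α := ℝ) N) (Nat.cast_nonneg (α := ℝ) k)]
  have hq : Real.sqrt ((k : ℝ) + 1) / ((k : ℝ) + 1) = 1 / Real.sqrt ((k : ℝ) + 1) :=
    Real.sqrt_div_self'
  rw [Real.norm_of_nonneg (by positivity), Real.norm_of_nonneg (by positivity),
    Finset.prod_range_succ, Nat.factorial_succ]
  calc _ = 2 * Real.sqrt ((N + k : ℕ) + 1) / ((k : ℝ) + 1) := by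
        push_cast
        field_simp
    _ ≤ 2 * (Real.sqrt (N + 1) * Real.sqrt ((k : ℝ) + 1)) / ((k : ℝ) + 1) := by gcongr
    _ = _ := by rw [← hq]; ring

theorem exists_norm_weyl_sub_le (ψ : finiteParticle H) : ∃ C : ℝ, ∀ h : H, ‖h‖ ≤ 1 →
    ‖weyl h (toFock ψ) - toFock ψ‖ ≤ C * ‖h‖ := by
  obtain ⟨N, hN⟩ := ψ.2
  set b : ℕ → ℝ := fun k =>
    (∏ j ∈ Finset.range k, 2 * Real.sqrt ((N + j : ℕ) + 1)) / k.factorial * partialNorm N ψ.1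
  have hb0 : ∀ k, 0 ≤ b k := fun k => mul_nonneg (div_nonneg (Finset.prod_nonneg fun j _ => by
    positivity) (by positivity)) (Finset.sum_nonneg fun _ _ => norm_nonneg _)
  have hb : Summable b := (summable_prod_sqrt_div_factorial N).mul_right _
  refine ⟨∑' k, b (k + 1), fun h hh => ?_⟩
  have hle : ∀ k, ‖expTerm (fieldOp h) ψ (k + 1)‖ ≤ b (k + 1) * ‖h‖ := by
    intro k
    obtain ⟨h1, h2⟩ := partialNorm_fieldOp_pow h hN (k + 1)
    have f : (0 : ℝ) < (k + 1).factorial := by exact_mod_cast (k + 1).factorial_pos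
    rw [expTerm, norm_smul, norm_div, norm_pow, Complex.norm_I, one_pow, Complex.norm_natCast,
      div_mul_eq_mul_div, one_mul, div_le_iff₀ f]
    refine ((norm_le_partialNorm h1).trans h2).trans ?_
    -- Without the zeroth term, which is ψ, each term carries at least one factor ‖h‖; the others
    -- are at most 1.
    have hpow : ‖h‖ ^ (k + 1) ≤ ‖h‖ := pow_le_of_le_one (norm_nonneg _) hh k.succ_ne_zero
    have e : b (k + 1) * ‖h‖ * (k + 1).factorial = ‖h‖ *
        (∏ j ∈ Finset.range (k + 1), 2 * Real.sqrt ((N + j : ℕ) + 1)) * partialNorm N ψ.1 := by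
      simp only [b]
      field_simp
    rw [e]
    have hp : 0 ≤ partialNorm N ψ.1 := Finset.sum_nonneg fun _ _ => norm_nonneg _
    have hq : 0 ≤ ∏ j ∈ Finset.range (k + 1), 2 * Real.sqrt ((N + j : ℕ) + 1) :=
      Finset.prod_nonneg fun j _ => by positivity
    gcongr
  have hs := (hasSum_nat_add_iff' 1).2 (hasSum_weyl h ψ)
  have e0 : ∑ i ∈ Finset.range 1, expTerm (fieldOp h) ψ i = ψ.1 := by simp [expTerm]
  rw [e0] at hs
  have hbs : HasSum (fun k => b (k + 1) * ‖h‖) ((∑' k, b (k + 1)) * ‖h‖) :=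
    (((summable_nat_add_iff 1).2 hb).hasSum).mul_right _
  have hn := norm_tsum_le_tsum_norm (hbs.summable.of_nonneg_of_le (fun _ => norm_nonneg _) hle)
  rw [hs.tsum_eq] at hn
  refine hn.trans (le_of_le_of_eq (Summable.tsum_le_tsum hle
    (hbs.summable.of_nonneg_of_le (fun _ => norm_nonneg _) hle) hbs.summable) hbs.tsum_eq)

/-- The Weyl operators are strongly continuous at `0`. -/
theorem tendsto_weyl (ψ : FockSpace H) :
    Filter.Tendsto (fun h : H => weyl h ψ) (nhds 0) (nhds ψ) := by
  rw [Metric.tendsto_nhds]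
  intro ε hε
  obtain ⟨φ, hφ⟩ := denseRange_toFock.exists_dist_lt ψ (by positivity : 0 < ε / 3)
  obtain ⟨C, hC⟩ := exists_norm_weyl_sub_le φ
  have hlim : Filter.Tendsto (fun h : H => C * ‖h‖) (nhds 0) (nhds 0) := by
    have : Filter.Tendsto (fun h : H => C * ‖h‖) (nhds 0) (nhds (C * ‖(0 : H)‖)) :=
      (continuous_const.mul continuous_norm).tendsto 0
    simpa using this
  filter_upwards [hlim.eventually (gt_mem_nhds (by positivity : 0 < ε / 3)),
    Metric.closedBall_mem_nhds (0 : H) one_pos] with h h1 h2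
  have h3 := hC h (mem_closedBall_zero_iff.1 h2)
  -- Isometry makes the approximation by a finite particle vector uniform in h.
  have h4 : dist (weyl h ψ) (weyl h (toFock φ)) = dist ψ (toFock φ) := by
    rw [dist_eq_norm, dist_eq_norm, ← map_sub, norm_weyl]
  rw [← dist_eq_norm] at h3
  have h5 := dist_triangle4 (weyl h ψ) (weyl h (toFock φ)) (toFock φ) ψ
  rw [dist_comm (toFock φ) ψ] at h5
  linarith

end WeylOperators

/-! ### Limits of vector states; functionals determined by the generators -/

section States
variable {F : Type*} [NormedAddCommGroup F] [InnerProductSpace ℂ F] [CompleteSpace F]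
  {A : StarSubalgebra ℂ (F →L[ℂ] F)}

theorem norm_vectorFunctional_le {Ψ : F} (hΨ : ‖Ψ‖ = 1) (B : A) :
    ‖vectorFunctional Ψ B‖ ≤ ‖B‖ := by
  refine (norm_inner_le_norm _ _).trans ?_
  rw [hΨ, one_mul]
  simpa [hΨ] using (B : F →L[ℂ] F).le_opNorm Ψ

theorem vectorFunctional_one {Ψ : F} (hΨ : ‖Ψ‖ = 1) : vectorFunctional Ψ (1 : A) = 1 := by
  have : vectorFunctional Ψ (1 : A) = inner ℂ Ψ Ψ := rfl
  rw [this, inner_self_eq_norm_sq_to_K, hΨ]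
  simp

theorem vectorFunctional_star_mul_self_nonneg (Ψ : F) (B : A) :
    0 ≤ vectorFunctional Ψ (star B * B) := by
  have : vectorFunctional Ψ (star B * B) =
      inner ℂ Ψ (ContinuousLinearMap.adjoint (B : F →L[ℂ] F) ((B : F →L[ℂ] F) Ψ)) := rfl
  rw [this, ContinuousLinearMap.adjoint_inner_right, inner_self_eq_norm_sq_to_K]
  rw [← RCLike.ofReal_pow]
  exact (RCLike.ofReal_nonneg (K := ℂ)).2 (sq_nonneg _)

/-- A bounded sequence of vector states has a weak-* limit point. -/
theorem exists_isState_of_tendsto (Ψ : ℕ → F) (hΨ : ∀ n, ‖Ψ n‖ = 1) :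
    ∃ ω : A →L[ℂ] ℂ, IsState ω ∧ ∀ (B : A) (c : ℂ),
      Filter.Tendsto (fun n => vectorFunctional (Ψ n) B) Filter.atTop (nhds c) → ω B = c := by
  -- A fixed free ultrafilter gives every bounded sequence of expectations a limit at once, so the
  -- limit is linear in B and no subsequence is chosen.
  have hex : ∀ B : A, ∃ c : ℂ, Filter.Tendsto (fun n => vectorFunctional (Ψ n) B)
      (Filter.hyperfilter ℕ : Filter ℕ) (nhds c) := fun B => by
    obtain ⟨c, -, hc⟩ := (isCompact_closedBall (0 : ℂ) ‖B‖).ultrafilter_le_nhds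
      ((Filter.hyperfilter ℕ).map fun n => vectorFunctional (Ψ n) B)
      (Filter.le_principal_iff.2 (Filter.mem_map.2 (Filter.univ_mem' fun n =>
        mem_closedBall_zero_iff.2 (norm_vectorFunctional_le (hΨ n) B))))
    exact ⟨c, hc⟩
  choose ω hω using hex
  have hle : ∀ B, ‖ω B‖ ≤ 1 * ‖B‖ := fun B => by
    rw [one_mul]
    exact le_of_tendsto (hω B).norm
      (Filter.Eventually.of_forall fun n => norm_vectorFunctional_le (hΨ n) B)
  let ωL : A →L[ℂ] ℂ := LinearMap.mkContinuous
    { toFun := ω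
      map_add' := fun B C => tendsto_nhds_unique (hω (B + C))
        (((hω B).add (hω C)).congr fun n => (inner_add_right _ _ _).symm)
      map_smul' := fun c B => tendsto_nhds_unique (hω (c • B))
        (((hω B).const_mul c).congr fun n => (inner_smul_right _ _ _).symm) } 1 hle
  have h1 : ωL 1 = 1 := tendsto_nhds_unique (hω 1)
    (tendsto_const_nhds.congr fun n => (vectorFunctional_one (hΨ n)).symm)
  refine ⟨ωL, ⟨fun B => ?_, le_antisymm (LinearMap.mkContinuous_norm_le _ zero_le_one _) ?_⟩,
    fun B c hc => ?_⟩
  · exact ge_of_tendsto (hω (star B * B))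
      (Filter.Eventually.of_forall fun n => vectorFunctional_star_mul_self_nonneg (Ψ n) B)
  · have h2 := ωL.le_opNorm 1
    have h3 : ‖(1 : A)‖ ≤ 1 := ContinuousLinearMap.norm_id_le (𝕜 := ℂ) (E := F)
    rw [h1, norm_one] at h2
    exact h2.trans (mul_le_of_le_one_right (norm_nonneg _) h3)
  · exact tendsto_nhds_unique (hω B) (hc.mono_left Nat.hyperfilter_le_atTop)

/-- Under these hypotheses the linear span of the generators already contains 1 and is closed under
products and adjoints. -/
theorem mem_span_of_mem_adjoin {ι : Type*} {W : ι → F →L[ℂ] F}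
    (hone : (1 : F →L[ℂ] F) ∈ Set.range W) (hstar : ∀ i, star (W i) ∈ Set.range W)
    (hmul : ∀ i j, W i * W j ∈ Submodule.span ℂ (Set.range W)) {B : F →L[ℂ] F}
    (hB : B ∈ StarAlgebra.adjoin ℂ (Set.range W)) : B ∈ Submodule.span ℂ (Set.range W) := by
  induction hB using StarAlgebra.adjoin_induction with
  | mem x hx => exact Submodule.subset_span hx
  | algebraMap r =>
    rw [Algebra.algebraMap_eq_smul_one]
    exact Submodule.smul_mem _ _ (Submodule.subset_span hone)
  | add x y _ _ hx hy => exact Submodule.add_mem _ hx hy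
  | mul x y _ _ hx hy =>
    have h := Submodule.mul_mem_mul hx hy
    rw [Submodule.span_mul_span] at h
    refine Submodule.span_le.2 ?_ h
    rintro _ ⟨_, ⟨i, rfl⟩, _, ⟨j, rfl⟩, rfl⟩
    exact hmul i j
  | star x hx' hx =>
    clear hx'
    induction hx using Submodule.span_induction with
    | mem x hx =>
      obtain ⟨i, rfl⟩ := hx
      exact Submodule.subset_span (hstar i)
    | zero => rw [star_zero]; exact Submodule.zero_mem _
    | add x y _ _ hx hy => rw [star_add]; exact Submodule.add_mem _ hx hy
    | smul c x _ hx => rw [star_smul]; exact Submodule.smul_mem _ _ hx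

/-- If the generators span a *-algebra, then continuous linear functionals on the generated C*-algebra
are determined by their values on the generators. -/
theorem eq_of_eq_on_generators {ι : Type*} {W : ι → F →L[ℂ] F}
    (hone : (1 : F →L[ℂ] F) ∈ Set.range W) (hstar : ∀ i, star (W i) ∈ Set.range W)
    (hmul : ∀ i j, W i * W j ∈ Submodule.span ℂ (Set.range W))
    {f g : generatedAlgebra W → ℂ} (hf : Continuous f) (hg : Continuous g)
    (hf' : IsLinearMap ℂ f) (hg' : IsLinearMap ℂ g)
    (h : ∀ i, f (generator W i) = g (generator W i)) : f = g := by
  have key : ∀ B ∈ Submodule.span ℂ (Set.range W),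
      ∃ hB : B ∈ generatedAlgebra W, f ⟨B, hB⟩ = g ⟨B, hB⟩ := fun B hB => by
    induction hB using Submodule.span_induction with
    | mem x hx =>
      obtain ⟨i, rfl⟩ := hx
      exact ⟨(generator W i).2, h i⟩
    | zero => exact ⟨zero_mem _, hf'.map_zero.trans hg'.map_zero.symm⟩
    | add x y _ _ hx hy =>
      obtain ⟨hx, ex⟩ := hx
      obtain ⟨hy, ey⟩ := hy
      refine ⟨add_mem hx hy, (hf'.map_add ⟨x, hx⟩ ⟨y, hy⟩).trans ?_⟩
      rw [ex, ey]
      exact (hg'.map_add ⟨x, hx⟩ ⟨y, hy⟩).symm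
    | smul c x _ hx =>
      obtain ⟨hx, ex⟩ := hx
      refine ⟨SMulMemClass.smul_mem c hx, (hf'.map_smul c ⟨x, hx⟩).trans ?_⟩
      rw [ex]
      exact (hg'.map_smul c ⟨x, hx⟩).symm
  funext B
  have hB : (B : F →L[ℂ] F) ∈ closure (StarAlgebra.adjoin ℂ (Set.range W) : Set (F →L[ℂ] F)) :=
    B.2
  obtain ⟨u, hu, hlim⟩ := mem_closure_iff_seq_limit.1 hB
  have hu' := fun n => key (u n) (mem_span_of_mem_adjoin hone hstar hmul (hu n))
  have hlim' : Filter.Tendsto (fun n => (⟨u n, (hu' n).1⟩ : generatedAlgebra W)) Filter.atTop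
      (nhds B) := tendsto_subtype_rng.2 hlim
  refine tendsto_nhds_unique ((hf.tendsto B).comp hlim') (((hg.tendsto B).comp hlim').congr
    fun n => ((hu' n).2).symm)

end States

/-! ### Coherent states: existence, uniqueness and the Fock criterion -/

section CoherentStates
variable {H : Type*} [NormedAddCommGroup H] [InnerProductSpace ℂ H]

/-- The Weyl relation and W(h)* = W(-h) keep products and adjoints in the span, as S is a group.
Linearity and continuity are separate hypotheses so that `vectorFunctional Ψ`, a bare function, is
admitted. -/
theorem eq_of_eq_on_weylElement {S : AddSubgroup H} {f g : weylAlgebra (S : Set H) → ℂ}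
    (hf : Continuous f) (hg : Continuous g) (hf' : IsLinearMap ℂ f) (hg' : IsLinearMap ℂ g)
    (h : ∀ i : (S : Set H), f (weylElement i) = g (weylElement i)) : f = g := by
  refine eq_of_eq_on_generators (F := FockSpace H) ⟨⟨0, S.zero_mem⟩, weyl_zero⟩
    (fun i => ⟨⟨-i.1, S.neg_mem i.2⟩, (star_weyl i.1).symm⟩) (fun i j => ?_) hf hg hf' hg' h
  rw [weyl_mul_weyl]
  exact Submodule.smul_mem _ _ (Submodule.subset_span ⟨⟨i.1 + j.1, S.add_mem i.2 j.2⟩, rfl⟩)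

theorem IsCoherentState.eq {S : Set H} {L : S → ℂ} {ω ω' : weylAlgebra S →L[ℂ] ℂ}
    (h : IsCoherentState L ω) (h' : IsCoherentState L ω') (G : AddSubgroup H)
    (hG : (G : Set H) = S) : ω = ω' := by
  subst hG
  exact DFunLike.coe_injective (eq_of_eq_on_weylElement ω.continuous ω'.continuous
    ω.toLinearMap.isLinear ω'.toLinearMap.isLinear
    fun i => (h.apply_weyl i).trans (h'.apply_weyl i).symm)

theorem vectorFunctional_weylElement {S : Set H} (Ψ : FockSpace H) (h : S) :
    vectorFunctional (F := FockSpace H) Ψ (weylElement h) = inner ℂ Ψ (weyl (h : H) Ψ) := rfl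

/-- The coherent vector of `J`. -/
def coherentVector (J : H) : FockSpace H :=
  weyl (-(Complex.I * ((Real.sqrt 2 : ℝ) : ℂ)) • J) (vacuum H)

theorem norm_coherentVector (J : H) : ‖coherentVector J‖ = 1 := by
  rw [coherentVector, norm_weyl, norm_vacuum]

theorem vectorFunctional_coherentVector {S : Set H} (J : H) (h : S) :
    vectorFunctional (F := FockSpace H) (coherentVector J) (weylElement h) =
      vectorFunctional (F := FockSpace H) (vacuum H) (weylElement h) *
        Complex.exp (Complex.I *
          ((Real.sqrt 2 * (inner ℂ J (h : H) : ℂ).re : ℝ) : ℂ)) := by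
  have e := inner_weyl_weyl_weyl (-(Complex.I * ((Real.sqrt 2 : ℝ) : ℂ)) • J) (h : H) (vacuum H)
  -- Antilinearity on the left turns -i√2 into i√2, and Im (iz) = Re z.
  have e2 : (inner ℂ (-(Complex.I * ((Real.sqrt 2 : ℝ) : ℂ)) • J) (h : H) : ℂ).im =
      Real.sqrt 2 * (inner ℂ J (h : H) : ℂ).re := by
    rw [inner_smul_left]
    simp
  rw [e2] at e
  rw [vectorFunctional_weylElement, vectorFunctional_weylElement, coherentVector]
  exact e.trans (mul_comm _ _)

/-- The coherent vectors of the J_n need not converge, but their expectations of each W(h) do; any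
limit point of their states has the required values. -/
theorem exists_isCoherentState {S : Set H} {L : S → ℂ} {J : ℕ → H}
    (hJ : ∀ h : S, Filter.Tendsto (fun n => (inner ℂ (J n) (h : H) : ℂ)) Filter.atTop
      (nhds (L h))) :
    ∃ ω : weylAlgebra S →L[ℂ] ℂ, IsCoherentState L ω := by
  have hΨ : ∀ n, ‖coherentVector (J n)‖ = 1 := fun n => norm_coherentVector (J n)
  have key := exists_isState_of_tendsto (F := FockSpace H) (A := weylAlgebra S) _ hΨ
  obtain ⟨ω, hω, hlim⟩ := key
  refine ⟨ω, hω, fun h => hlim _ _ ?_⟩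
  simp only [vectorFunctional_coherentVector]
  have hc : Continuous fun z : ℂ =>
      Complex.exp (Complex.I * ((Real.sqrt 2 * z.re : ℝ) : ℂ)) := by fun_prop
  exact (((hc.tendsto _).comp (hJ h)).const_mul _)

theorem IsCoherentState.isFockState {S : Set H} {L : S → ℂ} {ω : weylAlgebra S →L[ℂ] ℂ}
    (h : IsCoherentState L ω) (G : AddSubgroup H) (hG : (G : Set H) = S) {J : H}
    (hJ : ∀ g : S, L g = inner ℂ J (g : H)) : IsFockState ω := by
  subst hG
  refine ⟨coherentVector J, norm_coherentVector J, fun B => congrFun ?_ B⟩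
  refine eq_of_eq_on_weylElement ω.continuous ?_ ω.toLinearMap.isLinear
    ⟨fun B C => inner_add_right _ _ _, fun c B => inner_smul_right _ _ _⟩ fun g => ?_
  · unfold vectorFunctional
    fun_prop
  · rw [h.apply_weyl, vectorFunctional_coherentVector, hJ]

theorem tendsto_inner_weyl {Ψ : FockSpace H} (hΨ : ‖Ψ‖ = 1) :
    Filter.Tendsto (fun h : H => (inner ℂ Ψ (weyl h Ψ) : ℂ)) (nhds 0) (nhds 1) := by
  have e : (inner ℂ Ψ Ψ : ℂ) = 1 := by rw [inner_self_eq_norm_sq_to_K, hΨ]; simp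
  rw [← e]
  exact tendsto_const_nhds.inner (tendsto_weyl Ψ)

/-- Here b is the vacuum expectation of a Weyl operator and z the phase: if b and bz are near 1, so
is z. -/
theorem norm_sub_one_lt_half {b z : ℂ} (hz : ‖z‖ = 1) (h1 : ‖b * z - 1‖ < 1 / 4)
    (h2 : ‖b - 1‖ < 1 / 4) : ‖z - 1‖ < 1 / 2 := by
  have : z - 1 = (b * z - 1) - (b - 1) * z := by ring
  rw [this]
  refine (norm_sub_le _ _).trans_lt ?_
  rw [norm_mul, hz, mul_one]
  linarith

/-- A phase near 1 fixes its angle only modulo 2π; real homogeneity of L removes the ambiguity,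
because a large angle could be shrunk continuously through π. -/
theorem exists_abs_re_le_of_exp_near_one {S : Set H} {L : S → ℂ}
    (hS : ∀ (t : ℝ) (h : H), h ∈ S → (t : ℂ) • h ∈ S)
    (hL : ∀ (t : ℝ) (h : S), L ⟨(t : ℂ) • (h : H), hS t h h.2⟩ = t * L h) {δ : ℝ} (hδ : 0 < δ)
    (hexp : ∀ h : S, ‖(h : H)‖ < δ →
      ‖Complex.exp (Complex.I * ((Real.sqrt 2 * (L h).re : ℝ) : ℂ)) - 1‖ < 1 / 2) :
    ∃ C : ℝ, 0 ≤ C ∧ ∀ h : S, |(L h).re| ≤ C * ‖(h : H)‖ := by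
  have hpi : ∀ h : S, ‖(h : H)‖ < δ → |(L h).re| ≤ Real.pi := by
    intro h hh
    by_contra hcon
    rw [not_le] at hcon
    set θ := Real.sqrt 2 * (L h).re with hθ
    have h2 : 1 ≤ Real.sqrt 2 := Real.one_le_sqrt.2 (by norm_num)
    have hθpi : Real.pi < |θ| := by
      rw [hθ, abs_mul, abs_of_nonneg (by positivity)]
      nlinarith [Real.pi_pos]
    have hθ0 : θ ≠ 0 := fun h0 => by
      rw [h0, abs_zero] at hθpi
      exact absurd hθpi (not_lt.2 Real.pi_pos.le)
    have ht1 : |Real.pi / θ| ≤ 1 := by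
      rw [abs_div, abs_of_pos Real.pi_pos, div_le_one (by positivity)]
      exact hθpi.le
    -- The factor π/θ keeps h in the ball and makes the phase exactly -1, at distance 2 from 1.
    have h3 := hexp ⟨((Real.pi / θ : ℝ) : ℂ) • (h : H), hS _ _ h.2⟩ (by
      rw [norm_smul, Complex.norm_real, Real.norm_eq_abs]
      exact (mul_le_of_le_one_left (norm_nonneg _) ht1).trans_lt hh)
    rw [hL, Complex.re_ofReal_mul, mul_left_comm, ← hθ, div_mul_cancel₀ _ hθ0, mul_comm,
      Complex.exp_pi_mul_I] at h3
    have h5 : ‖(-1 - 1 : ℂ)‖ = 2 := by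
      rw [← neg_add', norm_neg, one_add_one_eq_two, Complex.norm_ofNat]
    rw [h5] at h3
    linarith
  -- The constant comes from rescaling h to norm δ/2, inside the open ball, where |Re L| ≤ π.
  refine ⟨2 * Real.pi / δ, by positivity, fun h => ?_⟩
  by_cases h0 : ‖(h : H)‖ = 0
  · have := hL 0 h
    have e : (⟨((0 : ℝ) : ℂ) • (h : H), hS 0 h h.2⟩ : S) = h :=
      Subtype.ext (by simp [norm_eq_zero.1 h0])
    rw [e, Complex.ofReal_zero, zero_mul] at this
    rw [this, h0, Complex.zero_re, abs_zero, mul_zero]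
  · have hpos : 0 < ‖(h : H)‖ := lt_of_le_of_ne (norm_nonneg _) (Ne.symm h0)
    have h4 := hpi ⟨((δ / (2 * ‖(h : H)‖) : ℝ) : ℂ) • (h : H), hS _ _ h.2⟩ (by
      rw [norm_smul, Complex.norm_real, Real.norm_of_nonneg (by positivity)]
      field_simp
      linarith)
    rw [hL, Complex.re_ofReal_mul, abs_mul, abs_of_pos (by positivity : 0 < δ / (2 * ‖(h : H)‖)),
      div_mul_eq_mul_div, div_le_iff₀ (by positivity)] at h4
    rw [div_mul_eq_mul_div, le_div_iff₀ hδ]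
    linarith

/-- If a coherent state is a Fock state, then the functional that defines it is bounded. -/
theorem IsCoherentState.exists_abs_re_le {S : Set H} {L : S → ℂ}
    {ω : weylAlgebra S →L[ℂ] ℂ} (hω : IsCoherentState L ω) (hF : IsFockState ω)
    (hS : ∀ (t : ℝ) (h : H), h ∈ S → (t : ℂ) • h ∈ S)
    (hL : ∀ (t : ℝ) (h : S), L ⟨(t : ℂ) • (h : H), hS t h h.2⟩ = t * L h) :
    ∃ C : ℝ, 0 ≤ C ∧ ∀ h : S, |(L h).re| ≤ C * ‖(h : H)‖ := by
  obtain ⟨Ψ, hΨ, hΨω⟩ := hF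
  -- One radius δ serves both Ψ and the vacuum, whose expectations differ by the phase.
  obtain ⟨δ, hδ, hball⟩ := Metric.eventually_nhds_iff.1
    (((tendsto_inner_weyl hΨ).eventually (Metric.ball_mem_nhds 1 (by norm_num : (0 : ℝ) < 1 / 4))).and
      ((tendsto_inner_weyl (norm_vacuum (H := H))).eventually
        (Metric.ball_mem_nhds 1 (by norm_num : (0 : ℝ) < 1 / 4))))
  have hexp : ∀ h : S, ‖(h : H)‖ < δ →
      ‖Complex.exp (Complex.I * ((Real.sqrt 2 * (L h).re : ℝ) : ℂ)) - 1‖ < 1 / 2 := by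
    intro h hh
    obtain ⟨h1, h2⟩ := hball (y := (h : H)) (by rwa [dist_zero_right])
    rw [dist_eq_norm] at h1 h2
    have e : (inner ℂ Ψ (weyl (h : H) Ψ) : ℂ) =
        inner ℂ (vacuum H) (weyl (h : H) (vacuum H)) *
          Complex.exp (Complex.I * ((Real.sqrt 2 * (L h).re : ℝ) : ℂ)) := by
      rw [← vectorFunctional_weylElement, ← hΨω, hω.apply_weyl, vectorFunctional_weylElement]
    rw [e] at h1
    refine norm_sub_one_lt_half ?_ h1 h2
    rw [mul_comm, Complex.norm_exp_ofReal_mul_I]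
  exact exists_abs_re_le_of_exp_near_one hS hL hδ hexp

end CoherentStates

/-! ### The one-photon space and the measure dp/(2ω) -/

section OnePhoton

theorem OnePhotonSpace.toFun_zero : (0 : OnePhotonSpace).toFun =ᵐ[photonMeasure] 0 :=
  Lp.coeFn_zero CVec 2 photonMeasure

theorem OnePhotonSpace.toFun_add (h g : OnePhotonSpace) :
    (h + g).toFun =ᵐ[photonMeasure] h.toFun + g.toFun :=
  Lp.coeFn_add (E := CVec) (p := 2) (μ := photonMeasure) _ _

theorem OnePhotonSpace.toFun_smul (c : ℂ) (h : OnePhotonSpace) :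
    (c • h).toFun =ᵐ[photonMeasure] c • h.toFun :=
  Lp.coeFn_smul (E := CVec) (p := 2) (μ := photonMeasure) c _

theorem OnePhotonSpace.aestronglyMeasurable (h : OnePhotonSpace) :
    AEStronglyMeasurable h.toFun photonMeasure :=
  Lp.aestronglyMeasurable (E := CVec) (p := 2) (μ := photonMeasure) _

theorem OnePhotonSpace.memLp (h : OnePhotonSpace) : MemLp h.toFun 2 photonMeasure :=
  Lp.memLp (E := CVec) (p := 2) (μ := photonMeasure) _

theorem OnePhotonSpace.inner_def (h g : OnePhotonSpace) :
    (inner ℂ h g : ℂ) = ∫ p, inner ℂ (h.toFun p) (g.toFun p) ∂photonMeasure :=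
  L2.inner_def (𝕜 := ℂ) (E := CVec) (μ := photonMeasure) _ _

theorem OnePhotonSpace.enorm_def (h : OnePhotonSpace) :
    ENNReal.ofReal ‖h‖ = eLpNorm h.toFun 2 photonMeasure := by
  have e : ‖h‖ = (eLpNorm h.toFun 2 photonMeasure).toReal :=
    Lp.norm_def (E := CVec) (p := 2) (μ := photonMeasure) _
  rw [e, ENNReal.ofReal_toReal h.memLp.2.ne]

/-- The element of the one photon space given by a square integrable transverse function. -/
def OnePhotonSpace.ofMemLp (f : Space → CVec) (hf : MemLp f 2 photonMeasure)
    (ht : ∀ p, ∑ k, (p k : ℂ) * f p k = 0) : OnePhotonSpace :=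
  show transverseFunctions from ⟨hf.toLp f, by
    filter_upwards [hf.coeFn_toLp] with p hp
    rw [hp, ht]⟩

theorem OnePhotonSpace.toFun_ofMemLp (f : Space → CVec) (hf : MemLp f 2 photonMeasure)
    (ht : ∀ p, ∑ k, (p k : ℂ) * f p k = 0) :
    (OnePhotonSpace.ofMemLp f hf ht).toFun =ᵐ[photonMeasure] f :=
  hf.coeFn_toLp

theorem smul_mem_rapidlyDecreasing (c : ℂ) {h : OnePhotonSpace} (hh : h ∈ rapidlyDecreasing) :
    c • h ∈ rapidlyDecreasing := fun k => by
  obtain ⟨C, hC⟩ := hh k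
  refine ⟨‖c‖ * C, ?_⟩
  filter_upwards [hC, h.toFun_smul c] with p h1 h2
  rw [h2, Pi.smul_apply, norm_smul, mul_assoc]
  exact mul_le_mul_of_nonneg_left h1 (norm_nonneg _)

/-- The rapidly decreasing functions as an additive group. -/
def rapidlyDecreasingSubgroup : AddSubgroup OnePhotonSpace where
  carrier := rapidlyDecreasing
  zero_mem' := fun k => ⟨0, by
    filter_upwards [OnePhotonSpace.toFun_zero] with p hp
    simp [hp]⟩
  add_mem' := fun {h g} hh hg k => by
    obtain ⟨C, hC⟩ := hh k
    obtain ⟨C', hC'⟩ := hg k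
    refine ⟨C + C', ?_⟩
    filter_upwards [hC, hC', h.toFun_add g] with p h1 h2 h3
    rw [h3, Pi.add_apply, add_mul]
    exact (norm_add_le _ _).trans (add_le_add h1 h2)
  neg_mem' := fun {h} hh => by
    have := smul_mem_rapidlyDecreasing (-1) hh
    rwa [neg_one_smul] at this

/-- In polar coordinates the density is r/(2(1 + r²)²), up to a constant, and is dominated by 1/(1 +
r²). Decay of order k = 2 therefore makes a rapidly decreasing function integrable against any
bounded J. -/
theorem integrable_inv_one_add_norm_sq_sq :
    Integrable (fun p : Space => ((1 + ‖p‖ ^ 2) ^ 2)⁻¹) photonMeasure := by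
  rw [photonMeasure, integrable_withDensity_iff (by fun_prop)
    (Filter.Eventually.of_forall fun _ => ENNReal.ofReal_lt_top)]
  have e : ∀ p : Space, (ENNReal.ofReal (1 / (2 * ‖p‖))).toReal = 1 / (2 * ‖p‖) := fun p =>
    ENNReal.toReal_ofReal (by positivity)
  simp only [e]
  rw [integrable_fun_norm_addHaar volume
    (f := fun r : ℝ => ((1 + r ^ 2) ^ 2)⁻¹ * (1 / (2 * r)))]
  refine (integrable_inv_one_add_sq.integrableOn).mono' (by fun_prop) ?_
  refine (ae_restrict_iff' measurableSet_Ioi).2 (Filter.Eventually.of_forall fun r hr => ?_)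
  have hr : 0 < r := hr
  rw [finrank_euclideanSpace_fin, smul_eq_mul, Real.norm_of_nonneg (by positivity)]
  rw [show r ^ (3 - 1) * (((1 + r ^ 2) ^ 2)⁻¹ * (1 / (2 * r))) =
    (r / 2) / (1 + r ^ 2) * (1 + r ^ 2)⁻¹ by field_simp]
  refine mul_le_of_le_one_left (by positivity) ?_
  rw [div_le_one (by positivity)]
  nlinarith [sq_nonneg (r - 1)]

/-- The integrable function above is bounded below by a positive constant on the ball; the
singularity 1/(2|p|) at the origin is thus harmless. -/
theorem photonMeasure_closedBall_lt_top (R : ℝ) :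
    photonMeasure (Metric.closedBall 0 R) < ∞ := by
  have h := integrable_inv_one_add_norm_sq_sq.measure_norm_ge_lt_top
    (ε := ((1 + R ^ 2) ^ 2)⁻¹) (by positivity)
  refine (measure_mono fun p hp => ?_).trans_lt h
  have hp' : ‖p‖ ≤ R := mem_closedBall_zero_iff.1 hp
  show ((1 + R ^ 2) ^ 2)⁻¹ ≤ ‖((1 + ‖p‖ ^ 2) ^ 2)⁻¹‖
  rw [Real.norm_of_nonneg (by positivity)]
  gcongr

end OnePhoton

/-! ### Momentum cut-offs, both as approximants and as test functions -/

section Truncation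

/-- The restriction of `J` to the momenta with `‖p‖ ≤ n`. -/
def truncate (J : Space → CVec) (n : ℕ) : Space → CVec := (Metric.closedBall 0 n).indicator J

variable {J : Space → CVec} {M : ℝ}

theorem measurable_truncate (hJ : Measurable J) (n : ℕ) : Measurable (truncate J n) :=
  hJ.indicator Metric.isClosed_closedBall.measurableSet

theorem norm_truncate_le (hM : ∀ p, ‖J p‖ ≤ M) (n : ℕ) (p : Space) : ‖truncate J n p‖ ≤ M :=
  (norm_indicator_le_norm_self _ _).trans (hM p)

theorem sum_mul_truncate (ht : ∀ p : Space, ∑ k, (p k : ℂ) * J p k = 0) (n : ℕ) (p : Space) :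
    ∑ k, (p k : ℂ) * truncate J n p k = 0 := by
  by_cases hp : p ∈ Metric.closedBall (0 : Space) n
  · rw [truncate, Set.indicator_of_mem hp]
    exact ht p
  · rw [truncate, Set.indicator_of_notMem hp]
    simp

theorem tendsto_truncate (J : Space → CVec) (p : Space) :
    Filter.Tendsto (fun n => truncate J n p) Filter.atTop (nhds (J p)) := by
  refine tendsto_const_nhds.congr' ?_
  obtain ⟨N, hN⟩ := exists_nat_ge ‖p‖
  filter_upwards [Filter.eventually_ge_atTop N] with n hn
  rw [truncate, Set.indicator_of_mem]
  exact mem_closedBall_zero_iff.2 (hN.trans (by exact_mod_cast hn))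

theorem inner_truncate_right (J : Space → CVec) (n : ℕ) (p : Space) :
    (inner ℂ (J p) (truncate J n p) : ℂ) = inner ℂ (truncate J n p) (truncate J n p) := by
  by_cases hp : p ∈ Metric.closedBall (0 : Space) n
  · rw [truncate, Set.indicator_of_mem hp]
  · rw [truncate, Set.indicator_of_notMem hp, inner_zero_right, inner_zero_right]

theorem memLp_truncate (hJ : Measurable J) (hM : ∀ p, ‖J p‖ ≤ M) (n : ℕ) :
    MemLp (truncate J n) 2 photonMeasure := by
  have : IsFiniteMeasure (photonMeasure.restrict (Metric.closedBall 0 (n : ℝ))) :=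
    ⟨by rw [Measure.restrict_apply_univ]; exact photonMeasure_closedBall_lt_top n⟩
  refine (memLp_indicator_iff_restrict Metric.isClosed_closedBall.measurableSet).2 ?_
  exact MemLp.of_bound hJ.aestronglyMeasurable M (Filter.Eventually.of_forall hM)

/-- The restriction of a bounded transverse function to `‖p‖ ≤ n`, in the one photon space. -/
def truncation (hJ : Measurable J) (hM : ∀ p, ‖J p‖ ≤ M)
    (ht : ∀ p : Space, ∑ k, (p k : ℂ) * J p k = 0) (n : ℕ) : OnePhotonSpace :=
  OnePhotonSpace.ofMemLp (truncate J n) (memLp_truncate hJ hM n) (sum_mul_truncate ht n)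

variable (hJ : Measurable J) (hM : ∀ p, ‖J p‖ ≤ M)
  (ht : ∀ p : Space, ∑ k, (p k : ℂ) * J p k = 0)

theorem toFun_truncation (n : ℕ) :
    (truncation hJ hM ht n).toFun =ᵐ[photonMeasure] truncate J n :=
  OnePhotonSpace.toFun_ofMemLp _ _ _

/-- Bounded support is enough, since no smoothness is asked for. This makes the cut-offs admissible
test functions. -/
theorem truncation_mem_rapidlyDecreasing (n : ℕ) :
    truncation hJ hM ht n ∈ rapidlyDecreasing := fun k => by
  have hM0 : 0 ≤ M := (norm_nonneg _).trans (hM 0)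
  refine ⟨M * (1 + (n : ℝ) ^ 2) ^ k, ?_⟩
  filter_upwards [toFun_truncation hJ hM ht n] with p hp
  rw [hp]
  by_cases hpn : p ∈ Metric.closedBall (0 : Space) n
  · have hp' : ‖p‖ ≤ n := mem_closedBall_zero_iff.1 hpn
    refine (norm_truncate_le hM n p).trans ?_
    rw [mul_assoc]
    refine le_mul_of_one_le_right hM0 ?_
    rw [← div_eq_mul_inv, one_le_div (by positivity)]
    gcongr
  · rw [truncate, Set.indicator_of_notMem hpn, norm_zero]
    positivity

/-- Dominated convergence: J is bounded and h has integrable decay of order k = 2. -/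
theorem tendsto_inner_truncation {h : OnePhotonSpace} (hh : h ∈ rapidlyDecreasing) :
    Filter.Tendsto (fun n => (inner ℂ (truncation hJ hM ht n) h : ℂ)) Filter.atTop
      (nhds (∫ p, inner ℂ (J p) (h.toFun p) ∂photonMeasure)) := by
  obtain ⟨C, hC⟩ := hh 2
  have e : ∀ n, (inner ℂ (truncation hJ hM ht n) h : ℂ) =
      ∫ p, inner ℂ (truncate J n p) (h.toFun p) ∂photonMeasure := fun n => by
    rw [OnePhotonSpace.inner_def]
    refine integral_congr_ae ?_
    filter_upwards [toFun_truncation hJ hM ht n] with p hp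
    rw [hp]
  simp only [e]
  refine tendsto_integral_of_dominated_convergence
    (fun p => M * (C * ((1 + ‖p‖ ^ 2) ^ 2)⁻¹)) (fun n => ?_)
    ((integrable_inv_one_add_norm_sq_sq.const_mul C).const_mul M) (fun n => ?_) ?_
  · exact (measurable_truncate hJ n).aestronglyMeasurable.inner h.aestronglyMeasurable
  · filter_upwards [hC] with p hp
    exact (norm_inner_le_norm _ _).trans (mul_le_mul (norm_truncate_le hM n p) hp (norm_nonneg _)
      ((norm_nonneg _).trans (hM p)))
  · exact Filter.Eventually.of_forall fun p => (tendsto_truncate J p).inner tendsto_const_nhds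

/-- J and its cut-off agree where the cut-off is nonzero, so this pairing is real, and a bound on
real parts controls it. -/
theorem integral_inner_truncation (n : ℕ) :
    ∫ p, inner ℂ (J p) ((truncation hJ hM ht n).toFun p) ∂photonMeasure =
      ((‖truncation hJ hM ht n‖ ^ 2 : ℝ) : ℂ) := by
  have e : (inner ℂ (truncation hJ hM ht n) (truncation hJ hM ht n) : ℂ) =
      ((‖truncation hJ hM ht n‖ ^ 2 : ℝ) : ℂ) := by
    rw [inner_self_eq_norm_sq_to_K]
    push_cast
    rfl
  rw [← e, OnePhotonSpace.inner_def]
  refine integral_congr_ae ?_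
  filter_upwards [toFun_truncation hJ hM ht n] with p hp
  rw [hp, inner_truncate_right]

end Truncation

/-! ### The main result for a bounded measurable transverse J -/

section CoherentPhotonStates

variable {J : Space → CVec} {M : ℝ}

/-- Fatou's lemma for the cut-offs, which converge pointwise to J. -/
theorem memLp_of_norm_truncation_le (hJ : Measurable J) (hM : ∀ p, ‖J p‖ ≤ M)
    (ht : ∀ p : Space, ∑ k, (p k : ℂ) * J p k = 0) {C : ℝ}
    (hC : ∀ n, ‖truncation hJ hM ht n‖ ≤ C) : MemLp J 2 photonMeasure := by
  refine ⟨hJ.aestronglyMeasurable, ?_⟩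
  have hle : ∀ n, eLpNorm (truncate J n) 2 photonMeasure ≤ ENNReal.ofReal C := fun n => by
    rw [← eLpNorm_congr_ae (toFun_truncation hJ hM ht n), ← OnePhotonSpace.enorm_def]
    exact ENNReal.ofReal_le_ofReal (hC n)
  refine (Lp.eLpNorm_lim_le_liminf_eLpNorm (f := truncate J)
    (fun n => (measurable_truncate hJ n).aestronglyMeasurable) J
    (Filter.Eventually.of_forall fun p => tendsto_truncate J p)).trans_lt ?_
  refine ((Filter.liminf_le_liminf (Filter.Eventually.of_forall hle)).trans
    (Filter.liminf_const _).le).trans_lt ENNReal.ofReal_lt_top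

/-- The pairing `(J, h)` of a function `J` of the momentum with a rapidly decreasing function. -/
def pairing (J : Space → CVec) (h : rapidlyDecreasing) : ℂ :=
  ∫ p, inner ℂ (J p) ((h : OnePhotonSpace).toFun p) ∂photonMeasure

theorem pairing_smul (J : Space → CVec) (t : ℝ) (h : rapidlyDecreasing) :
    pairing J ⟨(t : ℂ) • (h : OnePhotonSpace), smul_mem_rapidlyDecreasing t h.2⟩ =
      t * pairing J h := by
  rw [pairing, pairing, ← integral_const_mul]
  refine integral_congr_ae ?_
  filter_upwards [(h : OnePhotonSpace).toFun_smul t] with p hp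
  rw [hp, Pi.smul_apply, inner_smul_right]

theorem existsUnique_isCoherentState_pairing (hJ : Measurable J) (hM : ∀ p, ‖J p‖ ≤ M)
    (ht : ∀ p : Space, ∑ k, (p k : ℂ) * J p k = 0) :
    ∃! ω : fieldAlgebra →L[ℂ] ℂ, IsCoherentState (pairing J) ω := by
  have key : ∃ ω : fieldAlgebra →L[ℂ] ℂ, IsCoherentState (pairing J) ω :=
    exists_isCoherentState (S := rapidlyDecreasing) (J := truncation hJ hM ht)
      fun h => tendsto_inner_truncation hJ hM ht h.2
  obtain ⟨ω, hω⟩ := key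
  exact ⟨ω, hω, fun ω' hω' => hω'.eq hω rapidlyDecreasingSubgroup rfl⟩

theorem isFockState_iff_memOnePhotonSpace (hJ : Measurable J) (hM : ∀ p, ‖J p‖ ≤ M)
    (ht : ∀ p : Space, ∑ k, (p k : ℂ) * J p k = 0) {ω : fieldAlgebra →L[ℂ] ℂ}
    (hω : IsCoherentState (pairing J) ω) : IsFockState ω ↔ MemOnePhotonSpace J := by
  constructor
  · intro hF
    obtain ⟨C, hC0, hC⟩ := hω.exists_abs_re_le hF
      (fun t _ hh => smul_mem_rapidlyDecreasing (t : ℂ) hh) (pairing_smul J)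
    -- Testing with the cut-off itself gives ‖J_n‖² ≤ C‖J_n‖.
    have hle : ∀ n, ‖truncation hJ hM ht n‖ ≤ C := fun n => by
      have h1 := hC ⟨_, truncation_mem_rapidlyDecreasing hJ hM ht n⟩
      rw [pairing, integral_inner_truncation, Complex.ofReal_re, abs_of_nonneg (sq_nonneg _),
        sq] at h1
      by_contra hcon
      rw [not_le] at hcon
      exact absurd h1 (not_le.2 (mul_lt_mul_of_pos_right hcon (hC0.trans_lt hcon)))
    exact ⟨_, OnePhotonSpace.toFun_ofMemLp J (memLp_of_norm_truncation_le hJ hM ht hle) ht⟩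
  · rintro ⟨f, hf⟩
    refine hω.isFockState rapidlyDecreasingSubgroup rfl (J := f) fun g => ?_
    rw [OnePhotonSpace.inner_def]
    refine integral_congr_ae ?_
    filter_upwards [hf] with p hp
    rw [hp]

end CoherentPhotonStates

/-! ### The transverse current is measurable, bounded and transverse -/

section Current

theorem measurable_current_apply {x : ℝ → Space} (hx : Continuous x) (k : Fin 3) :
    Measurable fun p => current x p k := by
  have hd : Measurable fun s => deriv x s k := by
    have := measurable_deriv x
    fun_prop
  have hm : StronglyMeasurable (Function.uncurry fun (p : Space) (s : ℝ) => (deriv x s k : ℂ) *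
      Complex.exp (Complex.I * ((‖p‖ * s - inner ℝ p (x s) : ℝ) : ℂ))) := by
    refine Measurable.stronglyMeasurable ?_
    refine Measurable.mul ?_ (Continuous.measurable ?_)
    · exact Complex.measurable_ofReal.comp (hd.comp measurable_snd)
    · have := hx.comp (continuous_snd : Continuous (Prod.snd : Space × ℝ → ℝ))
      fun_prop
  exact hm.integral_prod_right.measurable.const_mul _

/-- A bound of the current by the total variation of the trajectory (finite if the velocity is
integrable, as for an absolutely continuous trajectory whose velocity has compact support). -/
theorem norm_current_apply_le (x : ℝ → Space) (p : Space) (k : Fin 3) :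
    ‖current x p k‖ ≤ (2 * Real.pi) ^ (-(3 / 2) : ℝ) * ∫ s, ‖deriv x s k‖ := by
  have h : ‖∫ s : ℝ, (deriv x s k : ℂ) *
      Complex.exp (Complex.I * ((‖p‖ * s - inner ℝ p (x s) : ℝ) : ℂ))‖ ≤
      ∫ s, ‖deriv x s k‖ := by
    refine (norm_integral_le_integral_norm _).trans (le_of_eq (integral_congr_ae ?_))
    refine Filter.Eventually.of_forall fun s => ?_
    simp only
    rw [norm_mul, mul_comm Complex.I, Complex.norm_exp_ofReal_mul_I, mul_one, Complex.norm_real]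
  have e : current x p k = -Complex.I * (((2 * Real.pi) ^ (-(3 / 2) : ℝ) : ℝ) : ℂ) *
      ∫ s : ℝ, (deriv x s k : ℂ) *
        Complex.exp (Complex.I * ((‖p‖ * s - inner ℝ p (x s) : ℝ) : ℂ)) := rfl
  rw [e, norm_mul, norm_mul, norm_neg, Complex.norm_I, one_mul, Complex.norm_real,
    Real.norm_of_nonneg (by positivity)]
  gcongr

theorem transverseProj_apply (p : Space) (v : CVec) (j : Fin 3) : transverseProj p v j =
    ∑ k, (((if j = k then 1 else 0) - p j * p k / ‖p‖ ^ 2 : ℝ) : ℂ) * v k := rfl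

/-- For p ≠ 0 the row vector p is annihilated by the matrix δ_{jk} - p_j p_k / |p|². At p = 0 the
sum vanishes because of the factor `p j`, so transversality holds at every p. -/
theorem sum_mul_transverseProj (p : Space) (v : CVec) :
    ∑ j, (p j : ℂ) * transverseProj p v j = 0 := by
  by_cases hp : p = 0
  · subst hp
    simp
  have hn : ((‖p‖ ^ 2 : ℝ) : ℂ) = p 0 ^ 2 + p 1 ^ 2 + p 2 ^ 2 := by
    rw [EuclideanSpace.real_norm_sq_eq, Fin.sum_univ_three]
    push_cast
    rfl
  have h0 : ((‖p‖ ^ 2 : ℝ) : ℂ) ≠ 0 := by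
    exact_mod_cast (pow_pos (norm_pos_iff.2 hp) 2).ne'
  simp only [transverseProj_apply, Fin.sum_univ_three, Complex.ofReal_sub, Complex.ofReal_div,
    Complex.ofReal_mul]
  generalize ((‖p‖ ^ 2 : ℝ) : ℂ) = n at hn h0
  simp
  field_simp
  rw [hn]
  ring

theorem abs_transverseProj_coeff_le (p : Space) (j k : Fin 3) :
    |(if j = k then 1 else 0) - p j * p k / ‖p‖ ^ 2| ≤ 2 := by
  have h1 : |p j * p k / ‖p‖ ^ 2| ≤ 1 := by
    rw [abs_div, abs_mul, abs_of_nonneg (sq_nonneg ‖p‖)]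
    -- This includes p = 0, where the quotient is 0 by convention.
    refine div_le_one_of_le₀ ?_ (sq_nonneg _)
    rw [sq]
    exact mul_le_mul (PiLp.norm_apply_le p j) (PiLp.norm_apply_le p k) (abs_nonneg _)
      (norm_nonneg _)
  have h2 : |(if j = k then 1 else 0 : ℝ)| ≤ 1 := by split_ifs <;> simp
  refine (abs_sub _ _).trans ?_
  linarith

theorem exists_norm_transverseCurrent_le (x : ℝ → Space) :
    ∃ M : ℝ, ∀ p, ‖transverseCurrent x p‖ ≤ M := by
  set B : ℝ := ∑ k : Fin 3, 2 * ((2 * Real.pi) ^ (-(3 / 2) : ℝ) * ∫ s, ‖deriv x s k‖)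
  have hB : ∀ p j, ‖transverseCurrent x p j‖ ≤ B := fun p j => by
    rw [transverseCurrent, transverseProj_apply]
    refine (norm_sum_le _ _).trans (Finset.sum_le_sum fun k _ => ?_)
    rw [norm_mul, Complex.norm_real]
    exact mul_le_mul (abs_transverseProj_coeff_le p j k) (norm_current_apply_le x p k)
      (norm_nonneg _) zero_le_two
  refine ⟨Real.sqrt (∑ _j : Fin 3, B ^ 2), fun p => Real.le_sqrt_of_sq_le ?_⟩
  rw [EuclideanSpace.norm_sq_eq]
  exact Finset.sum_le_sum fun j _ => pow_le_pow_left₀ (norm_nonneg _) (hB p j) 2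

theorem measurable_transverseCurrent {x : ℝ → Space} (hx : Continuous x) :
    Measurable (transverseCurrent x) := by
  have e : transverseCurrent x = WithLp.toLp 2 ∘ fun p j =>
      ∑ k, (((if j = k then 1 else 0) - p j * p k / ‖p‖ ^ 2 : ℝ) : ℂ) * current x p k := rfl
  rw [e]
  refine (WithLp.measurable_toLp 2 _).comp (measurable_pi_lambda _ fun j => ?_)
  refine Finset.measurable_sum _ fun k _ => ?_
  have hc : Measurable fun p : Space =>
      (((if j = k then 1 else 0) - p j * p k / ‖p‖ ^ 2 : ℝ) : ℂ) := by fun_prop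
  exact hc.mul (measurable_current_apply hx k)

theorem continuous_of_absolutelyContinuousOnInterval {E : Type*} [SeminormedAddCommGroup E]
    {x : ℝ → E} (hx : ∀ a b : ℝ, AbsolutelyContinuousOnInterval x a b) : Continuous x := by
  refine continuous_iff_continuousAt.2 fun s => ?_
  refine (hx (s - 1) (s + 1)).continuousOn.continuousAt ?_
  rw [Set.uIcc_of_le (by linarith)]
  exact Icc_mem_nhds (by linarith) (by linarith)

end Current

end PhotonField

end

theorem mainTheorem4 (x : ℝ → EuclideanSpace ℝ (Fin 3))
    (hx : ∀ a b : ℝ, AbsolutelyContinuousOnInterval x a b)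
    (hsupp : HasCompactSupport (deriv x)) :
    (∃! ω : PhotonField.fieldAlgebra →L[ℂ] ℂ, PhotonField.IsOutState x ω) ∧
      ∀ ω : PhotonField.fieldAlgebra →L[ℂ] ℂ, PhotonField.IsOutState x ω →
        (PhotonField.IsFockState ω ↔
          PhotonField.MemOnePhotonSpace (PhotonField.transverseCurrent x)) := by
  have hbound := PhotonField.exists_norm_transverseCurrent_le x
  obtain ⟨M, hM⟩ := hbound
  have hJ := PhotonField.measurable_transverseCurrent
    (PhotonField.continuous_of_absolutelyContinuousOnInterval hx)
  have ht : ∀ p : PhotonField.Space,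
      ∑ k, (p k : ℂ) * PhotonField.transverseCurrent x p k = 0 :=
    fun p => PhotonField.sum_mul_transverseProj p _
  -- By definition `currentPairing x` is the `pairing` of `transverseCurrent x`, so `IsOutState`
  -- unfolds to `IsCoherentState` for that pairing.
  exact ⟨PhotonField.existsUnique_isCoherentState_pairing hJ hM ht,
    fun ω hω => PhotonField.isFockState_iff_memOnePhotonSpace hJ hM ht hω⟩
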